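/- **Finite-time convergence of discounted agent-state-Markov policy gradient (ASMPG).** *Setting.* Let $\mathcal O,\mathcal S,\mathcal A$ be finite sets (observations, agent states, actions) and $\gamma\in(0,1)$. An infinite-horizon non-Markovian decision process is given by an initial law $\mu$ on $\mathcal O$, kernels $p_t(\cdot\mid o_{1:t},a_{1:t})$ on $\mathcal O$ and rewards $r_t(o_{1:t},a_{1:t})\in\mathbb R$, $t\ge1$, with $|r_t|\le r_{\max}$ for some $r_{\max}>0$. A stationary agent-state-Markov (ASM) policy is a kernel $\pi(s,a\mid\tilde s,\tilde a,o)$ from $\mathcal S\times\mathcal A\times\mathcal O$ to $\mathcal S\times\mathcal A$ (for instance a product $\nu(s\mid\tilde s,\tilde a,o)\,\phi(a\mid s)$). Playing $\pi$ generates a trajectory: $(S_0,A_0)=(s_0,a_0)$ is fixed, $O_1\sim\mu$, $(S_t,A_t)\sim\pi(\cdot\mid S_{t-1},A_{t-1},O_t)$ and $O_{t+1}\sim p_t(\cdot\mid O_{1:t},A_{1:t})$ for $t\ge1$. Let $(\pi_\theta)_{\theta\in\mathbb R^d}$ be stationary ASM policies whose probabilities are differentiable in $\theta$ and whose supports do not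 depend on $\theta$. Assume that there are $G,M>0$ such that, for all $\theta$ and all $(\tilde s,\tilde a,o)$, $(s,a)$ with $\pi_\theta(s,a\mid\tilde s,\tilde a,o)>0$, the function $\log\pi_\theta(s,a\mid\tilde s,\tilde a,o)$ is twice differentiable in $\theta$, with $$\|\nabla_\theta\log\pi_\theta(s,a\mid\tilde s,\tilde a,o)\|_2\le G,\qquad \|\nabla^2_\theta\log\pi_\theta(s,a\mid\tilde s,\tilde a,o)\|_2\le M .$$ Put $$J_\gamma(\theta)=\mathbb E_{\pi_\theta,\mu}\Big[\sum_{t\ge1}\gamma^{t-1}r_t(O_{1:t},A_{1:t})\Big],\quad \Delta_1=\sup_{\theta}J_\gamma(\theta)-J_\gamma(\theta_1),$$ $$C_\gamma=\frac{2r_{\max}G}{(1-\gamma)^2},\quad \beta_\gamma=\frac{r_{\max}}{(1-\gamma)^2}\Big(M+\frac{G^2(1+\gamma)}{1-\gamma}\Big).$$ *Algorithm.* Start from a deterministic $\theta_1\in\mathbb R^d$ with deterministic stepsizes $(\alpha_k)_{k\ge1}$. In episode $k=1,2,\dots$, given the trajectories of the previous episodes, sample a trajectory $(o^k_t,s^k_t,a^k_t)_{t\ge1}$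 by playing $\pi_{\theta_k}$, with $(s^k_0,a^k_0)=(s_0,a_0)$, and set $\theta_{k+1}=\theta_k+\alpha_k\widehat g_k$, where $$\widehat g_k=\sum_{t\ge1}\Big(\sum_{t'\ge t}\gamma^{t'-1}r_{t'}(o^k_{1:t'},a^k_{1:t'})\Big)\nabla_\theta\log\pi_{\theta_k}(s^k_t,a^k_t\mid s^k_{t-1},a^k_{t-1},o^k_t).$$ *Conclusion.* $J_\gamma$ is differentiable and bounded above, and the following hold. (a) Let $K\ge1$. If $\alpha_k=\min\Big\{\frac1{\beta_\gamma},\frac2{C_\gamma}\sqrt{\frac{2\Delta_1}{\beta_\gamma K}}\Big\}$ for $k=1,\dots,K$, then $\|\nabla J_\gamma(\theta_k)\|_2^2$ is integrable for $k\le K$ and $$\frac1K\sum_{k=1}^K\mathbb E\big[\|\nabla J_\gamma(\theta_k)\|_2^2\big]\le\frac{2\beta_\gamma\Delta_1}{K}+C_\gamma\sqrt{\frac{\beta_\gamma\Delta_1}{2K}} .$$ (b) Let $K\ge1$ and $\delta\in(0,1)$. (i) If $\alpha_k=\min\Big\{\frac1{\beta_\gamma},\frac1{C_\gamma}\sqrt{\frac{\Delta_1}{\beta_\gamma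 K}}\Big\}$ for $k=1,\dots,K$, then with probability at least $1-\delta$ $$\frac1K\sum_{k=1}^K\|\nabla J_\gamma(\theta_k)\|_2^2\le\frac{2\beta_\gamma\Delta_1}{K}+5C_\gamma\sqrt{\frac{\beta_\gamma\Delta_1}{K}}+\frac{12C_\gamma^2\log(1/\delta)}{K}.$$ (ii) If $\alpha_k=\frac1{\beta_\gamma\sqrt k}$ for $k=1,\dots,K$, then with probability at least $1-\delta$ $$\frac1K\sum_{k=1}^K\|\nabla J_\gamma(\theta_k)\|_2^2\le\frac{2\beta_\gamma\Delta_1+3C_\gamma^2(1+\log K)+12C_\gamma^2\log(1/\delta)}{\sqrt K}.$$ (c) If $\alpha_k>0$ for all $k$, $\sum_k\alpha_k=\infty$ and $\sum_k\alpha_k^2<\infty$, then $\|\nabla J_\gamma(\theta_k)\|_2\to0$ almost surely. -/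

import Mathlib

open scoped Gradient ProbabilityTheory

/-- The data of a non-Markovian decision process with observation space `O` and action space `A`.
Times are `t = 1, 2, …`; `p t o a` is the law of `O_{t+1}` given `O_{1:t} = o`, `A_{1:t} = a`, and
`r t o a` is the reward at time `t`.  The values at `t = 0` play no role. -/
structure NMDP (O A : Type*) where
  /-- law of the initial observation `O_1` -/
  init : PMF O
  /-- transition kernels -/
  p : (t : ℕ) → (Fin t → O) → (Fin t → A) → PMF O
  /-- reward functions -/
  r : (t : ℕ) → (Fin t → O) → (Fin t → A) → ℝ

/-- A stationary agent-state policy in its combined form: `π s a o` is the joint law of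
`(S_t, A_t)` given `(S_{t-1}, A_{t-1}, O_t) = (s, a, o)`. -/
abbrev ASMKernel (O S A : Type*) := S → A → O → PMF (S × A)

/-- Infinite trajectories; the entry with index `n` is `(O_{n+1}, S_{n+1}, A_{n+1})`. -/
abbrev Traj (O S A : Type*) := ℕ → O × S × A

namespace NMDP

variable {O S A : Type*}

/-- Joint law of `(O_1, S_1, A_1)`, the recursion being started at `(S_0, A_0) = (s₀, a₀)`. -/
noncomputable def firstPMF (N : NMDP O A) (s₀ : S) (a₀ : A) (π : ASMKernel O S A) :
    PMF (O × S × A) :=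
  N.init.bind fun o => (π s₀ a₀ o).map fun y => (o, y)

/-- Joint law of `(O_{n+2}, S_{n+2}, A_{n+2})` given the entries of times `1, …, n+1`. -/
noncomputable def stepPMF (N : NMDP O A) (π : ASMKernel O S A) (n : ℕ)
    (h : Finset.Iic n → O × S × A) : PMF (O × S × A) :=
  (N.p (n + 1)
      (fun i => (h ⟨i, Finset.mem_Iic.2 (Nat.lt_succ_iff.1 i.2)⟩).1)
      (fun i => (h ⟨i, Finset.mem_Iic.2 (Nat.lt_succ_iff.1 i.2)⟩).2.2)).bind fun o =>
    (π (h ⟨n, Finset.mem_Iic.2 le_rfl⟩).2.1 (h ⟨n, Finset.mem_Iic.2 le_rfl⟩).2.2 o).map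
      fun y => (o, y)

section Law

variable [Finite O] [Finite S] [Finite A]
  [MeasurableSpace O] [MeasurableSpace S] [MeasurableSpace A]
  [MeasurableSingletonClass O] [MeasurableSingletonClass S] [MeasurableSingletonClass A]

/-- `stepPMF` as a Markov kernel. -/
noncomputable def stepKernel (N : NMDP O A) (π : ASMKernel O S A) (n : ℕ) :
    ProbabilityTheory.Kernel (Finset.Iic n → O × S × A) (O × S × A) :=
  ProbabilityTheory.Kernel.ofFunOfCountable fun h => (N.stepPMF π n h).toMeasure

instance (N : NMDP O A) (π : ASMKernel O S A) (n : ℕ) :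
    ProbabilityTheory.IsMarkovKernel (N.stepKernel π n) :=
  ⟨fun h => inferInstanceAs (MeasureTheory.IsProbabilityMeasure (N.stepPMF π n h).toMeasure)⟩

/-- The law of the infinite trajectory generated by playing `π` in the environment `N`. -/
noncomputable def trajLaw (N : NMDP O A) (s₀ : S) (a₀ : A) (π : ASMKernel O S A) :
    MeasureTheory.Measure (Traj O S A) :=
  ProbabilityTheory.Kernel.trajMeasure (X := fun _ => O × S × A)
    (N.firstPMF s₀ a₀ π).toMeasure (N.stepKernel π)

end Law

/-- The reward `r_{n+1}(O_{1:n+1}, A_{1:n+1})` along a trajectory. -/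
def reward (N : NMDP O A) (τ : Traj O S A) (n : ℕ) : ℝ :=
  N.r (n + 1) (fun i => (τ i).1) (fun i => (τ i).2.2)

/-- `R^γ_{1:∞} = ∑_{t ≥ 1} γ^{t-1} r_t(O_{1:t}, A_{1:t})`. -/
noncomputable def discountedReturn (N : NMDP O A) (γ : ℝ) (τ : Traj O S A) : ℝ :=
  ∑' n : ℕ, γ ^ n * N.reward τ n

end NMDP

/-- `log π_θ(s, a ∣ s', a', o)` as a function of `θ`. -/
noncomputable def logPolicy {O S A : Type*} {d : ℕ}
    (π : EuclideanSpace ℝ (Fin d) → ASMKernel O S A) (s' : S) (a' : A) (o : O) (y : S × A)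
    (θ : EuclideanSpace ℝ (Fin d)) : ℝ :=
  Real.log (π θ s' a' o y).toReal

/-- The regularity assumptions on a parametrized stationary ASM policy: differentiability in `θ`,
support independent of `θ`, and, on the support, twice differentiable log-probabilities with score
bounded by `G` and Hessian bounded by `M` in operator norm. -/
structure IsRegularASM {O S A : Type*} {d : ℕ}
    (π : EuclideanSpace ℝ (Fin d) → ASMKernel O S A) (G M : ℝ) : Prop where
  differentiable : ∀ s' a' o y, Differentiable ℝ fun θ => (π θ s' a' o y).toReal
  support_indep : ∀ θ θ' s' a' o, (π θ s' a' o).support = (π θ' s' a' o).support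
  differentiable_score : ∀ s' a' o y, (∀ θ, y ∈ (π θ s' a' o).support) →
    Differentiable ℝ (∇ (logPolicy π s' a' o y))
  score_le : ∀ θ s' a' o, ∀ y ∈ (π θ s' a' o).support, ‖∇ (logPolicy π s' a' o y) θ‖ ≤ G
  hessian_le : ∀ θ s' a' o, ∀ y ∈ (π θ s' a' o).support,
    ‖fderiv ℝ (∇ (logPolicy π s' a' o y)) θ‖ ≤ M

namespace NMDP

variable {O S A : Type*} {d : ℕ}

/-- The score `∇_θ log π_θ(S_{n+1}, A_{n+1} ∣ S_n, A_n, O_{n+1})` along a trajectory, with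
`(S_0, A_0) = (s₀, a₀)`. -/
noncomputable def score (s₀ : S) (a₀ : A) (π : EuclideanSpace ℝ (Fin d) → ASMKernel O S A)
    (θ : EuclideanSpace ℝ (Fin d)) (τ : Traj O S A) : ℕ → EuclideanSpace ℝ (Fin d)
  | 0 => ∇ (logPolicy π s₀ a₀ (τ 0).1 (τ 0).2) θ
  | n + 1 => ∇ (logPolicy π (τ n).2.1 (τ n).2.2 (τ (n + 1)).1 (τ (n + 1)).2) θ

/-- The gradient estimate
`∑_{t ≥ 1} (∑_{t' ≥ t} γ^{t'-1} r_{t'}) ∇_θ log π_θ(S_t, A_t ∣ S_{t-1}, A_{t-1}, O_t)`. -/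
noncomputable def gradEst (N : NMDP O A) (γ : ℝ) (s₀ : S) (a₀ : A)
    (π : EuclideanSpace ℝ (Fin d) → ASMKernel O S A)
    (θ : EuclideanSpace ℝ (Fin d)) (τ : Traj O S A) : EuclideanSpace ℝ (Fin d) :=
  ∑' n : ℕ, (∑' m : ℕ, γ ^ (n + m) * N.reward τ (n + m)) • score s₀ a₀ π θ τ n

/-- The parameters of the algorithm as a function of the sampled trajectories.  Episodes are
counted from `0`: `iterate … τ k` is `θ_{k+1}`, `α k` is `α_{k+1}`, `τ k` is the trajectory of
episode `k + 1`. -/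
noncomputable def iterate (N : NMDP O A) (γ : ℝ) (s₀ : S) (a₀ : A)
    (π : EuclideanSpace ℝ (Fin d) → ASMKernel O S A) (α : ℕ → ℝ)
    (θ₁ : EuclideanSpace ℝ (Fin d)) (τ : ℕ → Traj O S A) : ℕ → EuclideanSpace ℝ (Fin d)
  | 0 => θ₁
  | k + 1 => N.iterate γ s₀ a₀ π α θ₁ τ k +
      α k • N.gradEst γ s₀ a₀ π (N.iterate γ s₀ a₀ π α θ₁ τ k) (τ k)

section Law

variable [Finite O] [Finite S] [Finite A]
  [MeasurableSpace O] [MeasurableSpace S] [MeasurableSpace A]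
  [MeasurableSingletonClass O] [MeasurableSingletonClass S] [MeasurableSingletonClass A]

/-- The objective `J_γ(θ) = E_{π_θ, μ}[R^γ_{1:∞}]`. -/
noncomputable def objective (N : NMDP O A) (γ : ℝ) (s₀ : S) (a₀ : A)
    (π : EuclideanSpace ℝ (Fin d) → ASMKernel O S A) (θ : EuclideanSpace ℝ (Fin d)) : ℝ :=
  ∫ τ, N.discountedReturn γ τ ∂(N.trajLaw s₀ a₀ (π θ))

/-- The random trajectories `τ 0, τ 1, …` on `(Ω, P)` are those of a run of the algorithm with
stepsizes `α` and initial parameter `θ₁`: given the trajectories of the previous episodes, the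
trajectory of the current episode is generated by playing the policy of the current parameter. -/
structure IsASMPGRun (N : NMDP O A) (γ : ℝ) (s₀ : S) (a₀ : A)
    (π : EuclideanSpace ℝ (Fin d) → ASMKernel O S A) (α : ℕ → ℝ)
    (θ₁ : EuclideanSpace ℝ (Fin d)) {Ω : Type*} [MeasurableSpace Ω]
    (P : MeasureTheory.Measure Ω) (τ : ℕ → Ω → Traj O S A) : Prop where
  measurable : ∀ k, Measurable (τ k)
  condLaw : ∀ (k : ℕ) (B : Set (Traj O S A)), MeasurableSet B →
    P⟦τ k ⁻¹' B | ⨆ j : Fin k, MeasurableSpace.comap (τ j) inferInstance⟧ =ᵐ[P]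
      fun ω => (N.trajLaw s₀ a₀ (π (N.iterate γ s₀ a₀ π α θ₁ (fun j => τ j ω) k))).real B

end Law

end NMDP

/-! The environment does not depend on `θ`, so the gradient of a path probability is that
probability times the sum of the scores along the path (`hasGradientAt_prefixProb`). Hence the
expected reward at time t has gradient E[r_t · (scores up to t)], bounded by rmax·t·G and Lipschitz
with constant rmax·(t²G² + tM). Summation against γ^(t-1) differentiates the objective
(`hasGradientAt_objective`) and yields the Lipschitz constant β (`norm_gradient_objective_sub_le`).
Regrouped by reward times, the estimator is seen to be unbiased (`integral_gradEst`); it is bounded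
by D = C/2.

What remains is stochastic gradient ascent, abstracted in `IsStochasticAscent`. The quadratic lower
bound for J telescopes on every sample path to ∑ α_k⟪∇J(θ_k), g_k⟫ ≤ Δ₁ + (βD²/2) ∑ α_k²
(`sum_inner_le`). For (a), expectation turns the left side into ∑ α_k E‖∇J(θ_k)‖². For (b), the
noise ⟪∇J, ∇J - g_k⟫ is conditionally sub-Gaussian with variance proxy D²‖∇J‖², proportional to the
very quantity to be bounded. The compensator of the exponential supermartingale is therefore
absorbed by the left side, and Markov's inequality costs only a log(1/δ) term (`prob_sum_le`). For
(c), the expectation bound gives ∑ α_k‖∇J(θ_k)‖² < ∞ almost surely, and a deterministic argument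
(`tendsto_zero_of_summable_mul_sq`) upgrades this to convergence. -/

open MeasureTheory

/-! ### Scores of a parametrized policy, on and off the support -/

section Policy

variable {O S A : Type*} {d : ℕ} {π : EuclideanSpace ℝ (Fin d) → ASMKernel O S A} {G M : ℝ}

/-- The support is the same for all `θ` and `Real.log 0 = 0`. Through this default value the score
and Hessian bounds extend to all outcomes, so later sums over paths need no restriction to the
support. -/
lemma IsRegularASM.logPolicy_eq_zero (hπ : IsRegularASM π G M) {s : S} {a : A} {o : O} {y : S × A}
    {θ : EuclideanSpace ℝ (Fin d)} (hy : y ∉ (π θ s a o).support) :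
    logPolicy π s a o y = fun _ => 0 := by
  funext θ'
  have : y ∉ (π θ' s a o).support := by rwa [hπ.support_indep θ' θ]
  rw [PMF.mem_support_iff, not_not] at this
  simp [logPolicy, this]

lemma IsRegularASM.norm_score_le (hπ : IsRegularASM π G M) (hG : 0 ≤ G) (θ : EuclideanSpace ℝ (Fin d))
    (s : S) (a : A) (o : O) (y : S × A) : ‖∇ (logPolicy π s a o y) θ‖ ≤ G := by
  by_cases hy : y ∈ (π θ s a o).support
  · exact hπ.score_le θ s a o y hy
  · simpa [hπ.logPolicy_eq_zero hy, gradient_fun_const] using hG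

lemma IsRegularASM.differentiable_gradient (hπ : IsRegularASM π G M)
    (s : S) (a : A) (o : O) (y : S × A) : Differentiable ℝ (∇ (logPolicy π s a o y)) := by
  by_cases hy : ∀ θ, y ∈ (π θ s a o).support
  · exact hπ.differentiable_score s a o y hy
  · obtain ⟨θ, hθ⟩ := not_forall.1 hy
    rw [hπ.logPolicy_eq_zero hθ, gradient_fun_const']
    exact differentiable_const _

lemma IsRegularASM.norm_hessian_le (hπ : IsRegularASM π G M) (hM : 0 ≤ M)
    (θ : EuclideanSpace ℝ (Fin d)) (s : S) (a : A) (o : O) (y : S × A) :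
    ‖fderiv ℝ (∇ (logPolicy π s a o y)) θ‖ ≤ M := by
  by_cases hy : y ∈ (π θ s a o).support
  · exact hπ.hessian_le θ s a o y hy
  · rw [hπ.logPolicy_eq_zero hy, gradient_fun_const']
    simpa using hM

/-- The log-derivative identity `∇π = π ∇ log π`, also valid off the support. -/
lemma IsRegularASM.hasGradientAt_policy (hπ : IsRegularASM π G M) (θ : EuclideanSpace ℝ (Fin d))
    (s : S) (a : A) (o : O) (y : S × A) :
    HasGradientAt (fun θ => (π θ s a o y).toReal)
      ((π θ s a o y).toReal • ∇ (logPolicy π s a o y) θ) θ := by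
  by_cases hy : y ∈ (π θ s a o).support
  · have hpos : (π θ s a o y).toReal ≠ 0 :=
      (ENNReal.toReal_pos ((PMF.mem_support_iff _ _).1 hy) (PMF.apply_ne_top _ _)).ne'
    have hd : HasFDerivAt (fun θ => (π θ s a o y).toReal) _ θ :=
      (hπ.differentiable s a o y θ).hasFDerivAt
    have hlog : HasFDerivAt (logPolicy π s a o y) _ θ := hd.log hpos
    have key : InnerProductSpace.toDual ℝ _ ((π θ s a o y).toReal • ∇ (logPolicy π s a o y) θ) =
        fderiv ℝ (fun θ => (π θ s a o y).toReal) θ := by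
      rw [gradient, hlog.fderiv, map_smul, map_smul, map_smul,
        LinearIsometryEquiv.apply_symm_apply, smul_smul, mul_inv_cancel₀ hpos, one_smul]
    rw [hasGradientAt_iff_hasFDerivAt, key]
    exact hd
  · have h0 : ∀ θ', (π θ' s a o y).toReal = 0 := by
      intro θ'
      have : y ∉ (π θ' s a o).support := by rwa [hπ.support_indep θ' θ]
      rw [PMF.mem_support_iff, not_not] at this
      simp [this]
    simp only [h0, zero_smul]
    exact hasGradientAt_const _ _

end Policy

/-! ### Finite prefixes of trajectories -/

section Prefix

variable {X : Type*}

/-- Extension of a finite trajectory to an infinite one, constant after time `n`. -/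
def prefixExt (n : ℕ) (h : Finset.Iic n → X) (i : ℕ) : X :=
  h ⟨min i n, Finset.mem_Iic.2 (min_le_right i n)⟩

/-- The first `n + 1` entries of an infinite trajectory. -/
def truncate (n : ℕ) (τ : ℕ → X) : Finset.Iic n → X := fun i => τ i

/-- Removal of the last entry. -/
def dropLast {n : ℕ} (h : Finset.Iic (n + 1) → X) : Finset.Iic n → X :=
  fun i => h ⟨i, Finset.mem_Iic.2 ((Finset.mem_Iic.1 i.2).trans n.le_succ)⟩

lemma prefixExt_truncate {n i : ℕ} (hi : i ≤ n) (τ : ℕ → X) :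
    prefixExt n (truncate n τ) i = τ i := by
  simp [prefixExt, truncate, hi]

lemma prefixExt_dropLast {n i : ℕ} (hi : i ≤ n) (h : Finset.Iic (n + 1) → X) :
    prefixExt n (dropLast h) i = prefixExt (n + 1) h i := by
  simp [prefixExt, dropLast, hi, hi.trans n.le_succ]

lemma measurable_truncate [MeasurableSpace X] (n : ℕ) : Measurable (truncate (X := X) n) :=
  measurable_pi_lambda _ fun i => measurable_pi_apply (i : ℕ)

/-- Such a function factors through `truncate n`, whose target is a countable discrete space. -/
lemma measurable_of_prefix {Y : Type*} [MeasurableSpace Y] [Countable X] [MeasurableSpace X]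
    [MeasurableSingletonClass X] {n : ℕ} {φ : (ℕ → X) → Y}
    (hφ : ∀ τ τ', (∀ i ≤ n, τ i = τ' i) → φ τ = φ τ') : Measurable φ := by
  have h : φ = (fun h => φ (prefixExt n h)) ∘ truncate n :=
    funext fun τ => hφ _ _ fun i hi => (prefixExt_truncate hi τ).symm
  rw [h]
  exact (measurable_of_countable _).comp (measurable_truncate n)

lemma eq_of_dropLast_eq {n : ℕ} {h h' : Finset.Iic (n + 1) → X} (h₁ : dropLast h = dropLast h')
    (h₂ : prefixExt (n + 1) h (n + 1) = prefixExt (n + 1) h' (n + 1)) : h = h' := by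
  funext ⟨i, hi⟩
  rcases Nat.le_succ_iff.1 (Finset.mem_Iic.1 hi) with hi' | rfl
  · exact congrFun h₁ ⟨i, Finset.mem_Iic.2 hi'⟩
  · simpa [prefixExt] using h₂

end Prefix

/-! ### Path probabilities and their gradients -/

lemma PMF.bind_map_prodMk_apply {α β : Type*} (p : PMF α) (q : α → PMF β) (x : α × β) :
    (p.bind fun a => (q a).map fun b => (a, b)) x = p x.1 * q x.1 x.2 := by
  obtain ⟨a, b⟩ := x
  classical
  rw [PMF.bind_apply, tsum_eq_single a]
  · rw [PMF.map_apply, tsum_eq_single b]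
    · simp
    · intro b' hb'
      simp [hb'.symm]
  · intro a' ha'
    simp [PMF.map_apply, ha'.symm]

namespace NMDP

variable {O S A : Type*} {d : ℕ}

lemma reward_congr (N : NMDP O A) {τ τ' : Traj O S A} {n : ℕ} (h : ∀ i ≤ n, τ i = τ' i) :
    N.reward τ n = N.reward τ' n := by
  have h' : ∀ i : Fin (n + 1), τ i = τ' i := fun i => h i (Nat.lt_succ_iff.1 i.2)
  simp only [reward, h']

lemma score_congr (s₀ : S) (a₀ : A) (π : EuclideanSpace ℝ (Fin d) → ASMKernel O S A)
    (θ : EuclideanSpace ℝ (Fin d)) {τ τ' : Traj O S A} {n : ℕ} (h : ∀ i ≤ n, τ i = τ' i) :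
    score s₀ a₀ π θ τ n = score s₀ a₀ π θ τ' n := by
  cases n with
  | zero => simp only [score, h 0 le_rfl]
  | succ n => simp only [score, h (n + 1) le_rfl, h n n.le_succ]

section Law

variable [Fintype O] [Fintype S] [Fintype A]
  [MeasurableSpace O] [MeasurableSpace S] [MeasurableSpace A]
  [MeasurableSingletonClass O] [MeasurableSingletonClass S] [MeasurableSingletonClass A]

instance isProbabilityMeasure_trajLaw (N : NMDP O A) (s₀ : S) (a₀ : A) (π : ASMKernel O S A) :
    IsProbabilityMeasure (N.trajLaw s₀ a₀ π) :=
  inferInstanceAs (IsProbabilityMeasure (ProbabilityTheory.Kernel.trajMeasure _ _))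

/-- Probability that the first `n + 1` entries of the trajectory are `h`. -/
noncomputable def prefixProb (N : NMDP O A) (s₀ : S) (a₀ : A) (π : ASMKernel O S A) (n : ℕ)
    (h : Finset.Iic n → O × S × A) : ℝ :=
  (N.trajLaw s₀ a₀ π).real (truncate n ⁻¹' {h})

lemma prefixProb_nonneg (N : NMDP O A) (s₀ : S) (a₀ : A) (π : ASMKernel O S A) (n : ℕ)
    (h : Finset.Iic n → O × S × A) : 0 ≤ N.prefixProb s₀ a₀ π n h := measureReal_nonneg

/-- Reduces expectations at a fixed time to finite sums, which can be differentiated in `θ` without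
any interchange of limits. -/
lemma integral_eq_sum_prefixProb {E : Type*} [NormedAddCommGroup E] [NormedSpace ℝ E]
    [CompleteSpace E] (N : NMDP O A) (s₀ : S) (a₀ : A) (π : ASMKernel O S A) {n : ℕ} {φ : Traj O S A → E}
    (hφ : ∀ τ τ' : Traj O S A, (∀ i ≤ n, τ i = τ' i) → φ τ = φ τ') :
    ∫ τ, φ τ ∂(N.trajLaw s₀ a₀ π) = ∑ h, N.prefixProb s₀ a₀ π n h • φ (prefixExt n h) := by
  have h1 : ∀ τ, φ τ = (fun h => φ (prefixExt n h)) (truncate n τ) := fun τ =>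
    hφ _ _ fun i hi => (prefixExt_truncate hi τ).symm
  rw [integral_congr_ae (Filter.Eventually.of_forall h1),
    ← integral_map (f := fun h => φ (prefixExt n h)) (measurable_truncate n).aemeasurable
      (StronglyMeasurable.of_discrete).aestronglyMeasurable]
  have : IsProbabilityMeasure ((N.trajLaw s₀ a₀ π).map (truncate n)) :=
    Measure.isProbabilityMeasure_map (measurable_truncate n).aemeasurable
  rw [integral_fintype (Integrable.of_finite)]
  refine Finset.sum_congr rfl fun h _ => ?_
  rw [map_measureReal_apply (measurable_truncate n) (measurableSet_singleton h)]
  rfl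

lemma sum_prefixProb (N : NMDP O A) (s₀ : S) (a₀ : A) (π : ASMKernel O S A) (n : ℕ) :
    ∑ h, N.prefixProb s₀ a₀ π n h = 1 := by
  simpa using (N.integral_eq_sum_prefixProb s₀ a₀ π (n := n) (φ := fun _ => (1 : ℝ))
    (fun _ _ _ => rfl)).symm

lemma prefixProb_zero (N : NMDP O A) (s₀ : S) (a₀ : A) (π : ASMKernel O S A)
    (h : Finset.Iic 0 → O × S × A) :
    N.prefixProb s₀ a₀ π 0 h = (N.init (prefixExt 0 h 0).1).toReal *
      (π s₀ a₀ (prefixExt 0 h 0).1 (prefixExt 0 h 0).2).toReal := by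
  have h0 : (N.trajLaw s₀ a₀ π).map (truncate 0) =
      (N.firstPMF s₀ a₀ π).toMeasure.map
        (MeasurableEquiv.piUnique (fun _ : Finset.Iic 0 => O × S × A)).symm := by
    have := ProbabilityTheory.Kernel.traj_map_frestrictLe (X := fun _ => O × S × A)
      (κ := N.stepKernel π) 0 0
    rw [ProbabilityTheory.Kernel.partialTraj_self] at this
    change Measure.map (Preorder.frestrictLe 0) (ProbabilityTheory.Kernel.trajMeasure
      (X := fun _ => O × S × A) _ _) = _
    rw [ProbabilityTheory.Kernel.trajMeasure, Measure.map_comp _ _ (by fun_prop), this,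
      Measure.id_comp]
  have h1 : N.prefixProb s₀ a₀ π 0 h = ((N.trajLaw s₀ a₀ π).map (truncate 0)).real {h} := by
    rw [map_measureReal_apply (measurable_truncate 0) (measurableSet_singleton h)]
    rfl
  rw [h1, h0, map_measureReal_apply (by fun_prop) (measurableSet_singleton h)]
  have h2 : (MeasurableEquiv.piUnique (fun _ : Finset.Iic 0 => O × S × A)).symm ⁻¹' {h} =
      {prefixExt 0 h 0} := by
    ext x
    simp only [Set.mem_preimage, Set.mem_singleton_iff]
    rw [MeasurableEquiv.symm_apply_eq]
    rfl
  rw [h2, Measure.real, PMF.toMeasure_apply_singleton _ _ (measurableSet_singleton _), firstPMF,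
    PMF.bind_map_prodMk_apply, ENNReal.toReal_mul]

/-- The joint law of a prefix and the next entry is the prefix law composed with the step kernel;
this identity is evaluated on a product of singletons. -/
lemma prefixProb_succ (N : NMDP O A) (s₀ : S) (a₀ : A) (π : ASMKernel O S A) (n : ℕ)
    (h : Finset.Iic (n + 1) → O × S × A) :
    N.prefixProb s₀ a₀ π (n + 1) h = N.prefixProb s₀ a₀ π n (dropLast h) *
      (N.stepPMF π n (dropLast h) (prefixExt (n + 1) h (n + 1))).toReal := by
  have key := ProbabilityTheory.Kernel.map_frestrictLe_trajMeasure_compProd_eq_map_trajMeasure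
    (X := fun _ => O × S × A) (μ₀ := (N.firstPMF s₀ a₀ π).toMeasure) (κ := N.stepKernel π) (a := n)
  change ((N.trajLaw s₀ a₀ π).map (truncate n)) ⊗ₘ (N.stepKernel π n) =
    (N.trajLaw s₀ a₀ π).map (fun x => (truncate n x, x (n + 1))) at key
  have hm : Measurable fun x : Traj O S A => (truncate n x, x (n + 1)) :=
    (measurable_truncate n).prodMk (measurable_pi_apply _)
  have : IsProbabilityMeasure ((N.trajLaw s₀ a₀ π).map (truncate n)) :=
    Measure.isProbabilityMeasure_map (measurable_truncate n).aemeasurable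
  have key' := congrArg
    (fun m => m ({dropLast h} ×ˢ {prefixExt (n + 1) h (n + 1)})) key
  rw [Measure.compProd_apply_prod (measurableSet_singleton _) (measurableSet_singleton _),
    Measure.map_apply hm ((measurableSet_singleton _).prod (measurableSet_singleton _)),
    lintegral_singleton, Measure.map_apply (measurable_truncate n) (measurableSet_singleton _)]
    at key'
  have hset : (fun x : Traj O S A => (truncate n x, x (n + 1))) ⁻¹'
      ({dropLast h} ×ˢ {prefixExt (n + 1) h (n + 1)}) = truncate (n + 1) ⁻¹' {h} := by
    ext x
    simp only [Set.mem_preimage, Set.mem_prod, Set.mem_singleton_iff]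
    constructor
    · rintro ⟨h1, h2⟩
      refine eq_of_dropLast_eq h1 ?_
      rw [prefixExt_truncate le_rfl, h2]
    · rintro rfl
      exact ⟨rfl, (prefixExt_truncate le_rfl x).symm⟩
  rw [hset] at key'
  rw [prefixProb, Measure.real, ← key', ENNReal.toReal_mul, mul_comm]
  congr 2
  exact PMF.toMeasure_apply_singleton _ _ (measurableSet_singleton _)

/-- The log-derivative identity for path probabilities. -/
lemma hasGradientAt_prefixProb (N : NMDP O A) (s₀ : S) (a₀ : A)
    {π : EuclideanSpace ℝ (Fin d) → ASMKernel O S A} {G M : ℝ} (hπ : IsRegularASM π G M)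
    (θ : EuclideanSpace ℝ (Fin d)) (n : ℕ) (h : Finset.Iic n → O × S × A) :
    HasGradientAt (fun θ => N.prefixProb s₀ a₀ (π θ) n h)
      (N.prefixProb s₀ a₀ (π θ) n h •
        ∑ i ∈ Finset.range (n + 1), score s₀ a₀ π θ (prefixExt n h) i) θ := by
  induction n with
  | zero =>
    simp only [prefixProb_zero]
    have := (hπ.hasGradientAt_policy θ s₀ a₀ (prefixExt 0 h 0).1 (prefixExt 0 h 0).2)
    rw [hasGradientAt_iff_hasFDerivAt] at this ⊢
    convert! this.const_mul (N.init (prefixExt 0 h 0).1).toReal using 1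
    simp [score, mul_smul]
  | succ n ih =>
    -- The factor from `N.p` is constant in `θ`, so the product rule adds exactly one score.
    have hstep : ∀ θ, (N.stepPMF (π θ) n (dropLast h) (prefixExt (n + 1) h (n + 1))).toReal =
        (N.p (n + 1) (fun i => (prefixExt (n + 1) h i).1)
          (fun i => (prefixExt (n + 1) h i).2.2) (prefixExt (n + 1) h (n + 1)).1).toReal *
        (π θ (prefixExt (n + 1) h n).2.1 (prefixExt (n + 1) h n).2.2
          (prefixExt (n + 1) h (n + 1)).1 (prefixExt (n + 1) h (n + 1)).2).toReal := by
      intro θ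
      have h1 : ∀ i (hi : i ≤ n), dropLast h ⟨i, Finset.mem_Iic.2 hi⟩ =
          prefixExt (n + 1) h i := by
        intro i hi
        rw [← prefixExt_dropLast hi]
        simp [prefixExt, hi]
      have h2 : ∀ i : Fin (n + 1), dropLast h ⟨i, Finset.mem_Iic.2 (Nat.lt_succ_iff.1 i.2)⟩ =
          prefixExt (n + 1) h i := fun i => h1 i (Nat.lt_succ_iff.1 i.2)
      rw [stepPMF, PMF.bind_map_prodMk_apply, ENNReal.toReal_mul]
      simp only [h2, h1 n le_rfl]
    simp only [prefixProb_succ, hstep]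
    have h1 := ih (dropLast h)
    have h2 := hπ.hasGradientAt_policy θ (prefixExt (n + 1) h n).2.1 (prefixExt (n + 1) h n).2.2
          (prefixExt (n + 1) h (n + 1)).1 (prefixExt (n + 1) h (n + 1)).2
    rw [hasGradientAt_iff_hasFDerivAt] at h1 h2 ⊢
    have h3 : ∑ i ∈ Finset.range (n + 1), score s₀ a₀ π θ (prefixExt n (dropLast h)) i =
        ∑ i ∈ Finset.range (n + 1), score s₀ a₀ π θ (prefixExt (n + 1) h) i :=
      Finset.sum_congr rfl fun i hi => score_congr _ _ _ _ fun j hj =>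
        prefixExt_dropLast (hj.trans (Nat.lt_succ_iff.1 (Finset.mem_range.1 hi))) h
    convert! h1.mul (h2.const_mul _) using 1
    rw [Finset.sum_range_succ _ (n + 1), h3, score]
    simp only [map_smul, map_add, smul_add, smul_smul]
    rw [add_comm]
    congr 2
    ring

end Law

end NMDP

/-! ### The two power series behind C and β -/

section Series

lemma hasSum_succ_mul_geometric {γ : ℝ} (hγ₀ : 0 ≤ γ) (hγ₁ : γ < 1) :
    HasSum (fun n : ℕ => γ ^ n * ((n : ℝ) + 1)) (1 / (1 - γ) ^ 2) := by
  have h := hasSum_choose_mul_geometric_of_norm_lt_one 1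
    (r := γ) (by rwa [Real.norm_of_nonneg hγ₀])
  convert! h using 2 with n
  push_cast [Nat.choose_one_right]
  ring

/-- Uses (n+1)² = 2·choose (n+2) 2 - (n+1). -/
lemma hasSum_succ_sq_mul_geometric {γ : ℝ} (hγ₀ : 0 ≤ γ) (hγ₁ : γ < 1) :
    HasSum (fun n : ℕ => γ ^ n * ((n : ℝ) + 1) ^ 2) ((1 + γ) / (1 - γ) ^ 3) := by
  have h := ((hasSum_choose_mul_geometric_of_norm_lt_one 2
    (r := γ) (by rwa [Real.norm_of_nonneg hγ₀])).mul_left 2).sub (hasSum_succ_mul_geometric hγ₀ hγ₁)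
  have h1 : 1 - γ ≠ 0 := (sub_pos.2 hγ₁).ne'
  convert! h using 1
  · funext n
    rw [Nat.cast_choose_two]
    push_cast
    ring
  · field_simp
    ring

end Series

/-! ### Expected rewards at a fixed time: gradient and Lipschitz constant -/

namespace NMDP

variable {O S A : Type*} {d : ℕ}

lemma abs_reward_le {N : NMDP O A} {rmax : ℝ} (hr : ∀ t, 1 ≤ t → ∀ o a, |N.r t o a| ≤ rmax)
    (τ : Traj O S A) (n : ℕ) : |N.reward τ n| ≤ rmax :=
  hr _ (Nat.le_add_left 1 n) _ _

section Score

variable {π : EuclideanSpace ℝ (Fin d) → ASMKernel O S A} {G M : ℝ}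

lemma norm_score_le (hπ : IsRegularASM π G M) (hG : 0 ≤ G) (s₀ : S) (a₀ : A)
    (θ : EuclideanSpace ℝ (Fin d)) (τ : Traj O S A) (n : ℕ) : ‖score s₀ a₀ π θ τ n‖ ≤ G := by
  cases n <;> exact hπ.norm_score_le hG _ _ _ _ _

lemma differentiable_score (hπ : IsRegularASM π G M) (s₀ : S) (a₀ : A)
    (τ : Traj O S A) (n : ℕ) : Differentiable ℝ fun θ => score s₀ a₀ π θ τ n := by
  cases n <;> exact hπ.differentiable_gradient _ _ _ _

lemma norm_fderiv_score_le (hπ : IsRegularASM π G M) (hM : 0 ≤ M) (s₀ : S) (a₀ : A)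
    (θ : EuclideanSpace ℝ (Fin d)) (τ : Traj O S A) (n : ℕ) :
    ‖fderiv ℝ (fun θ => score s₀ a₀ π θ τ n) θ‖ ≤ M := by
  cases n <;> exact hπ.norm_hessian_le hM _ _ _ _ _

/-- The score of the first `n + 1` steps of a trajectory. -/
noncomputable def scoreSum (s₀ : S) (a₀ : A) (π : EuclideanSpace ℝ (Fin d) → ASMKernel O S A)
    (θ : EuclideanSpace ℝ (Fin d)) (τ : Traj O S A) (n : ℕ) : EuclideanSpace ℝ (Fin d) :=
  ∑ i ∈ Finset.range (n + 1), score s₀ a₀ π θ τ i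

lemma scoreSum_congr (s₀ : S) (a₀ : A) (π : EuclideanSpace ℝ (Fin d) → ASMKernel O S A)
    (θ : EuclideanSpace ℝ (Fin d)) {τ τ' : Traj O S A} {n : ℕ} (h : ∀ i ≤ n, τ i = τ' i) :
    scoreSum s₀ a₀ π θ τ n = scoreSum s₀ a₀ π θ τ' n :=
  Finset.sum_congr rfl fun _ hi => score_congr _ _ _ _ fun j hj =>
    h j (hj.trans (Nat.lt_succ_iff.1 (Finset.mem_range.1 hi)))

lemma norm_scoreSum_le (hπ : IsRegularASM π G M) (hG : 0 ≤ G) (s₀ : S) (a₀ : A)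
    (θ : EuclideanSpace ℝ (Fin d)) (τ : Traj O S A) (n : ℕ) :
    ‖scoreSum s₀ a₀ π θ τ n‖ ≤ (n + 1) * G := by
  refine (norm_sum_le_of_le _ fun i _ => norm_score_le hπ hG s₀ a₀ θ τ i).trans ?_
  simp

lemma differentiable_scoreSum (hπ : IsRegularASM π G M) (s₀ : S) (a₀ : A)
    (τ : Traj O S A) (n : ℕ) : Differentiable ℝ fun θ => scoreSum s₀ a₀ π θ τ n :=
  Differentiable.fun_sum fun i _ => differentiable_score hπ s₀ a₀ τ i

lemma norm_fderiv_scoreSum_le (hπ : IsRegularASM π G M) (hM : 0 ≤ M) (s₀ : S) (a₀ : A)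
    (θ : EuclideanSpace ℝ (Fin d)) (τ : Traj O S A) (n : ℕ) :
    ‖fderiv ℝ (fun θ => scoreSum s₀ a₀ π θ τ n) θ‖ ≤ (n + 1) * M := by
  simp only [scoreSum]
  rw [fderiv_fun_sum fun i _ => differentiable_score hπ s₀ a₀ τ i θ]
  refine (norm_sum_le_of_le _ fun i _ => norm_fderiv_score_le hπ hM s₀ a₀ θ τ i).trans ?_
  simp

lemma norm_reward_smul_scoreSum_le {N : NMDP O A} {rmax : ℝ} {s₀ : S} {a₀ : A}
    (hr : ∀ t, 1 ≤ t → ∀ o a, |N.r t o a| ≤ rmax)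
    (hrmax : 0 ≤ rmax) (hπ : IsRegularASM π G M) (hG : 0 ≤ G) (θ : EuclideanSpace ℝ (Fin d))
    (τ : Traj O S A) (n : ℕ) :
    ‖N.reward τ n • scoreSum s₀ a₀ π θ τ n‖ ≤ rmax * ((n + 1) * G) := by
  rw [norm_smul]
  exact mul_le_mul (abs_reward_le hr τ n) (norm_scoreSum_le hπ hG s₀ a₀ θ τ n) (norm_nonneg _) hrmax

end Score

section Law

variable [Fintype O] [Fintype S] [Fintype A]
  [MeasurableSpace O] [MeasurableSpace S] [MeasurableSpace A]
  [MeasurableSingletonClass O] [MeasurableSingletonClass S] [MeasurableSingletonClass A]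

lemma measurable_reward (N : NMDP O A) (n : ℕ) :
    Measurable fun τ : Traj O S A => N.reward τ n :=
  measurable_of_prefix (n := n) fun _ _ h => N.reward_congr h

lemma measurable_scoreSum (s₀ : S) (a₀ : A) (π : EuclideanSpace ℝ (Fin d) → ASMKernel O S A)
    (θ : EuclideanSpace ℝ (Fin d)) (n : ℕ) :
    Measurable fun τ : Traj O S A => scoreSum s₀ a₀ π θ τ n :=
  measurable_of_prefix (n := n) fun _ _ h => scoreSum_congr s₀ a₀ π θ h

/-- The gradient of the expected reward at time `n + 1`. -/
noncomputable def rewardGrad (N : NMDP O A) (s₀ : S) (a₀ : A)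
    (π : EuclideanSpace ℝ (Fin d) → ASMKernel O S A) (n : ℕ) (θ : EuclideanSpace ℝ (Fin d)) :
    EuclideanSpace ℝ (Fin d) :=
  ∫ τ, N.reward τ n • scoreSum s₀ a₀ π θ τ n ∂(N.trajLaw s₀ a₀ (π θ))

lemma rewardGrad_eq_sum (N : NMDP O A) (s₀ : S) (a₀ : A)
    (π : EuclideanSpace ℝ (Fin d) → ASMKernel O S A) (n : ℕ) (θ : EuclideanSpace ℝ (Fin d)) :
    N.rewardGrad s₀ a₀ π n θ = ∑ h, N.prefixProb s₀ a₀ (π θ) n h •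
      (N.reward (prefixExt n h) n • scoreSum s₀ a₀ π θ (prefixExt n h) n) :=
  N.integral_eq_sum_prefixProb s₀ a₀ (π θ) fun τ τ' h => by
    rw [N.reward_congr h, scoreSum_congr s₀ a₀ π θ h]

variable {N : NMDP O A} {rmax G M : ℝ} {s₀ : S} {a₀ : A}
  {π : EuclideanSpace ℝ (Fin d) → ASMKernel O S A}

lemma hasGradientAt_expectedReward (hπ : IsRegularASM π G M) (n : ℕ)
    (θ : EuclideanSpace ℝ (Fin d)) :
    HasGradientAt (fun θ => ∫ τ, N.reward τ n ∂(N.trajLaw s₀ a₀ (π θ)))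
      (N.rewardGrad s₀ a₀ π n θ) θ := by
  simp only [N.integral_eq_sum_prefixProb s₀ a₀ _ fun τ τ' h => N.reward_congr h]
  rw [rewardGrad_eq_sum, hasGradientAt_iff_hasFDerivAt, map_sum]
  refine HasFDerivAt.fun_sum fun h _ => ?_
  have h1 := N.hasGradientAt_prefixProb s₀ a₀ hπ θ n h
  rw [hasGradientAt_iff_hasFDerivAt] at h1
  convert! h1.mul_const (N.reward (prefixExt n h) n) using 1
  simp only [scoreSum, map_smul, smul_smul]
  rw [mul_comm]

lemma norm_rewardGrad_le (hr : ∀ t, 1 ≤ t → ∀ o a, |N.r t o a| ≤ rmax) (hrmax : 0 ≤ rmax)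
    (hπ : IsRegularASM π G M) (hG : 0 ≤ G) (n : ℕ) (θ : EuclideanSpace ℝ (Fin d)) :
    ‖N.rewardGrad s₀ a₀ π n θ‖ ≤ rmax * ((n + 1) * G) := by
  have := norm_integral_le_of_norm_le_const (μ := N.trajLaw s₀ a₀ (π θ))
    (Filter.Eventually.of_forall fun τ => norm_reward_smul_scoreSum_le
      (s₀ := s₀) (a₀ := a₀) hr hrmax hπ hG θ τ n)
  simpa [rewardGrad] using this

/-- With S the accumulated score, the derivative of E[r S] is E[r (∇S + S ⊗ S)]: one term from
differentiating S, one from the path probabilities. The two give (n+1)M and (n+1)²G², and the mean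
value inequality concludes. -/
lemma norm_rewardGrad_sub_le (hr : ∀ t, 1 ≤ t → ∀ o a, |N.r t o a| ≤ rmax) (hrmax : 0 ≤ rmax)
    (hπ : IsRegularASM π G M) (hG : 0 ≤ G) (hM : 0 ≤ M) (n : ℕ)
    (θ θ' : EuclideanSpace ℝ (Fin d)) :
    ‖N.rewardGrad s₀ a₀ π n θ' - N.rewardGrad s₀ a₀ π n θ‖ ≤
      rmax * ((n + 1) ^ 2 * G ^ 2 + (n + 1) * M) * ‖θ' - θ‖ := by
  have hd : ∀ θ, ∃ D : EuclideanSpace ℝ (Fin d) →L[ℝ] EuclideanSpace ℝ (Fin d), HasFDerivAt (N.rewardGrad s₀ a₀ π n) D θ ∧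
      ‖D‖ ≤ rmax * ((n + 1) ^ 2 * G ^ 2 + (n + 1) * M) := by
    intro θ
    have h1 := fun h => (hasGradientAt_iff_hasFDerivAt.1
      (N.hasGradientAt_prefixProb s₀ a₀ hπ θ n h)).smul
      (((differentiable_scoreSum hπ s₀ a₀ (prefixExt n h) n θ).hasFDerivAt).const_smul
        (N.reward (prefixExt n h) n))
    have h2 := HasFDerivAt.fun_sum (u := Finset.univ) fun h _ => h1 h
    refine ⟨_, h2.congr_of_eventuallyEq (Filter.Eventually.of_forall fun θ =>
      rewardGrad_eq_sum N s₀ a₀ π n θ), ?_⟩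
    suffices h : _ ≤ (∑ h, N.prefixProb s₀ a₀ (π θ) n h) *
        (rmax * ((n + 1) ^ 2 * G ^ 2 + (n + 1) * M)) by rwa [sum_prefixProb, one_mul] at h
    rw [Finset.sum_mul]
    refine norm_sum_le_of_le _ fun h _ => ?_
    have hp := N.prefixProb_nonneg s₀ a₀ (π θ) n h
    have hS := norm_scoreSum_le hπ hG s₀ a₀ θ (prefixExt n h) n
    have hS' := norm_fderiv_scoreSum_le hπ hM s₀ a₀ θ (prefixExt n h) n
    have hR : ‖N.reward (prefixExt n h) n‖ ≤ rmax := abs_reward_le hr (prefixExt n h) n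
    refine (norm_add_le _ _).trans ?_
    rw [ContinuousLinearMap.norm_smulRight_apply, Pi.smul_apply, norm_smul, norm_smul,
      norm_smul, LinearIsometryEquiv.norm_map, norm_smul, Real.norm_of_nonneg hp]
    change _ * (_ * ‖fderiv ℝ (fun θ => scoreSum s₀ a₀ π θ (prefixExt n h) n) θ‖) +
      _ * ‖scoreSum s₀ a₀ π θ (prefixExt n h) n‖ *
        (_ * ‖scoreSum s₀ a₀ π θ (prefixExt n h) n‖) ≤ _
    calc _ = N.prefixProb s₀ a₀ (π θ) n h * (‖N.reward (prefixExt n h) n‖ *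
          (‖scoreSum s₀ a₀ π θ (prefixExt n h) n‖ ^ 2 +
            ‖fderiv ℝ (fun θ => scoreSum s₀ a₀ π θ (prefixExt n h) n) θ‖)) := by ring
      _ ≤ N.prefixProb s₀ a₀ (π θ) n h * (rmax * (((n + 1) * G) ^ 2 + (n + 1) * M)) := by
          gcongr
      _ = _ := by ring
  choose D hD hD' using hd
  exact Convex.norm_image_sub_le_of_norm_hasFDerivWithin_le
    (fun θ _ => (hD θ).hasFDerivWithinAt) (fun θ _ => hD' θ) convex_univ trivial trivial

end Law

end NMDP

/-! ### The gradient estimate, the policy gradient and its smoothness -/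

namespace NMDP

variable {O S A : Type*} {d : ℕ} {N : NMDP O A} {γ rmax G M : ℝ} {s₀ : S} {a₀ : A}
  {π : EuclideanSpace ℝ (Fin d) → ASMKernel O S A}

section Estimator

lemma norm_discounted_reward_le (hγ₀ : 0 ≤ γ) (hr : ∀ t, 1 ≤ t → ∀ o a, |N.r t o a| ≤ rmax)
    (τ : Traj O S A) (n k : ℕ) : ‖γ ^ n * N.reward τ k‖ ≤ γ ^ n * rmax := by
  rw [norm_mul, Real.norm_of_nonneg (by positivity)]
  exact mul_le_mul_of_nonneg_left (abs_reward_le hr τ k) (by positivity)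

lemma summable_discounted_reward (hγ₀ : 0 ≤ γ) (hγ₁ : γ < 1)
    (hr : ∀ t, 1 ≤ t → ∀ o a, |N.r t o a| ≤ rmax) (τ : Traj O S A) (n : ℕ) :
    Summable fun m => γ ^ (n + m) * N.reward τ (n + m) := by
  refine Summable.of_norm_bounded (g := fun m => γ ^ n * γ ^ m * rmax)
    (((summable_geometric_of_lt_one hγ₀ hγ₁).mul_left _).mul_right _) fun m => ?_
  rw [← pow_add]
  exact norm_discounted_reward_le hγ₀ hr τ _ _

lemma norm_tsum_discounted_reward_le (hγ₀ : 0 ≤ γ) (hγ₁ : γ < 1)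
    (hr : ∀ t, 1 ≤ t → ∀ o a, |N.r t o a| ≤ rmax) (τ : Traj O S A) (n : ℕ) :
    ‖∑' m, γ ^ (n + m) * N.reward τ (n + m)‖ ≤ γ ^ n * (rmax / (1 - γ)) := by
  refine tsum_of_norm_bounded (g := fun m => γ ^ n * γ ^ m * rmax) ?_ fun m => ?_
  · convert! ((hasSum_geometric_of_lt_one hγ₀ hγ₁).mul_left (γ ^ n)).mul_right rmax using 1
    ring
  · rw [← pow_add]
    exact norm_discounted_reward_le hγ₀ hr τ _ _

/-- The terms of the gradient estimate are dominated by a geometric series. -/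
lemma norm_gradEst_term_le (hγ₀ : 0 ≤ γ) (hγ₁ : γ < 1)
    (hr : ∀ t, 1 ≤ t → ∀ o a, |N.r t o a| ≤ rmax) (hrmax : 0 ≤ rmax)
    (hπ : IsRegularASM π G M) (hG : 0 ≤ G) (θ : EuclideanSpace ℝ (Fin d)) (τ : Traj O S A)
    (n : ℕ) :
    ‖(∑' m : ℕ, γ ^ (n + m) * N.reward τ (n + m)) • score s₀ a₀ π θ τ n‖ ≤
      γ ^ n * (rmax / (1 - γ) * G) := by
  rw [norm_smul, ← mul_assoc]
  have := sub_pos.2 hγ₁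
  exact mul_le_mul (norm_tsum_discounted_reward_le hγ₀ hγ₁ hr τ n)
    (norm_score_le hπ hG s₀ a₀ θ τ n) (norm_nonneg _) (by positivity)

lemma norm_gradEst_le (hγ₀ : 0 ≤ γ) (hγ₁ : γ < 1)
    (hr : ∀ t, 1 ≤ t → ∀ o a, |N.r t o a| ≤ rmax) (hrmax : 0 ≤ rmax)
    (hπ : IsRegularASM π G M) (hG : 0 ≤ G) (θ : EuclideanSpace ℝ (Fin d)) (τ : Traj O S A) :
    ‖N.gradEst γ s₀ a₀ π θ τ‖ ≤ rmax * G / (1 - γ) ^ 2 := by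
  refine tsum_of_norm_bounded ?_
    (norm_gradEst_term_le (s₀ := s₀) (a₀ := a₀) hγ₀ hγ₁ hr hrmax hπ hG θ τ)
  convert! (hasSum_geometric_of_lt_one hγ₀ hγ₁).mul_right (rmax / (1 - γ) * G) using 1
  field_simp

/-- Summation by parts: the gradient estimate groups the scores by reward times. -/
lemma gradEst_eq_tsum (hγ₀ : 0 ≤ γ) (hγ₁ : γ < 1)
    (hr : ∀ t, 1 ≤ t → ∀ o a, |N.r t o a| ≤ rmax) (hrmax : 0 ≤ rmax)
    (hπ : IsRegularASM π G M) (hG : 0 ≤ G) (θ : EuclideanSpace ℝ (Fin d)) (τ : Traj O S A) :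
    N.gradEst γ s₀ a₀ π θ τ = ∑' n, γ ^ n • (N.reward τ n • scoreSum s₀ a₀ π θ τ n) := by
  let F : ℕ × ℕ → EuclideanSpace ℝ (Fin d) := fun p =>
    (γ ^ (p.1 + p.2) * N.reward τ (p.1 + p.2)) • score s₀ a₀ π θ τ p.1
  -- Absolute summability over pairs (score time, delay until the reward) permits resummation along
  -- antidiagonals, that is, by reward time.
  have hF : Summable F := by
    have h := (summable_geometric_of_lt_one hγ₀ hγ₁).mul_of_nonneg
      (summable_geometric_of_lt_one hγ₀ hγ₁) (fun _ => by positivity) (fun _ => by positivity)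
    refine Summable.of_norm_bounded (h.mul_right (rmax * G)) fun p => ?_
    rw [norm_smul, ← pow_add, ← mul_assoc]
    exact mul_le_mul (norm_discounted_reward_le hγ₀ hr τ _ _) (norm_score_le hπ hG s₀ a₀ θ τ _)
      (norm_nonneg _) (by positivity)
  have h1 : N.gradEst γ s₀ a₀ π θ τ = ∑' n, ∑' m, F (n, m) :=
    tsum_congr fun n => ((summable_discounted_reward hγ₀ hγ₁ hr τ n).tsum_smul_const _).symm
  have h2 := (Finset.HasAntidiagonal.sigmaAntidiagonalEquivProd.summable_iff.2 hF).tsum_sigma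
  simp only [Function.comp_def] at h2
  rw [h1, ← hF.tsum_prod, ← Finset.HasAntidiagonal.sigmaAntidiagonalEquivProd.tsum_eq F, h2]
  refine tsum_congr fun n => ?_
  rw [tsum_fintype, Finset.univ_eq_attach,
    Finset.sum_congr rfl fun b _ => congrArg F
      (Finset.HasAntidiagonal.sigmaAntidiagonalEquivProd_apply ⟨n, b⟩),
    Finset.sum_attach (Finset.HasAntidiagonal.antidiagonal n) (fun p => F p),
    Finset.Nat.sum_antidiagonal_eq_sum_range_succ_mk, scoreSum, Finset.smul_sum, Finset.smul_sum]
  refine Finset.sum_congr rfl fun i hi => ?_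
  have : i + (n - i) = n := Nat.add_sub_cancel' (Nat.lt_succ_iff.1 (Finset.mem_range.1 hi))
  simp only [F, this, smul_smul]

end Estimator

section Law

variable [Fintype O] [Fintype S] [Fintype A]
  [MeasurableSpace O] [MeasurableSpace S] [MeasurableSpace A]
  [MeasurableSingletonClass O] [MeasurableSingletonClass S] [MeasurableSingletonClass A]

lemma objective_eq_tsum (hγ₀ : 0 ≤ γ) (hγ₁ : γ < 1)
    (hr : ∀ t, 1 ≤ t → ∀ o a, |N.r t o a| ≤ rmax) (θ : EuclideanSpace ℝ (Fin d)) :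
    N.objective γ s₀ a₀ π θ = ∑' n, γ ^ n * ∫ τ, N.reward τ n ∂(N.trajLaw s₀ a₀ (π θ)) := by
  have h := hasSum_integral_of_summable_integral_norm (μ := N.trajLaw s₀ a₀ (π θ))
    (F := fun (n : ℕ) τ => γ ^ n * N.reward τ n) (fun n => ?_) ?_
  · rw [objective]
    simp only [discountedReturn]
    rw [← h.tsum_eq]
    exact tsum_congr fun n => integral_const_mul _ _
  · exact Integrable.of_bound ((measurable_reward N n).const_mul _).aestronglyMeasurable
      (γ ^ n * rmax) (Filter.Eventually.of_forall fun τ => norm_discounted_reward_le hγ₀ hr τ n n)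
  · refine Summable.of_norm_bounded (g := fun n => γ ^ n * rmax)
      ((summable_geometric_of_lt_one hγ₀ hγ₁).mul_right _) fun n => ?_
    simpa using norm_integral_le_of_norm_le_const (μ := N.trajLaw s₀ a₀ (π θ))
      (f := fun τ => ‖γ ^ n * N.reward τ n‖) (C := γ ^ n * rmax)
      (Filter.Eventually.of_forall fun τ => by
        rw [norm_norm]; exact norm_discounted_reward_le hγ₀ hr τ n n)

lemma abs_objective_le (hγ₀ : 0 ≤ γ) (hγ₁ : γ < 1)
    (hr : ∀ t, 1 ≤ t → ∀ o a, |N.r t o a| ≤ rmax) (θ : EuclideanSpace ℝ (Fin d)) :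
    |N.objective γ s₀ a₀ π θ| ≤ rmax / (1 - γ) := by
  have h : ∀ τ : Traj O S A, ‖N.discountedReturn γ τ‖ ≤ rmax / (1 - γ) := fun τ => by
    simpa [discountedReturn] using norm_tsum_discounted_reward_le hγ₀ hγ₁ hr τ 0
  simpa [objective] using norm_integral_le_of_norm_le_const (μ := N.trajLaw s₀ a₀ (π θ))
    (Filter.Eventually.of_forall h)

/-- The policy gradient theorem. -/
lemma hasGradientAt_objective (hγ₀ : 0 ≤ γ) (hγ₁ : γ < 1)
    (hr : ∀ t, 1 ≤ t → ∀ o a, |N.r t o a| ≤ rmax) (hrmax : 0 ≤ rmax)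
    (hπ : IsRegularASM π G M) (hG : 0 ≤ G) (θ : EuclideanSpace ℝ (Fin d)) :
    HasGradientAt (N.objective γ s₀ a₀ π) (∑' n, γ ^ n • N.rewardGrad s₀ a₀ π n θ) θ := by
  have hs : Summable fun n : ℕ => γ ^ n * ((n : ℝ) + 1) * (rmax * G) :=
    (hasSum_succ_mul_geometric hγ₀ hγ₁).summable.mul_right _
  have hb : ∀ (n : ℕ) θ, ‖γ ^ n • N.rewardGrad s₀ a₀ π n θ‖ ≤
      γ ^ n * ((n : ℝ) + 1) * (rmax * G) := fun n θ => by
    rw [norm_smul, Real.norm_of_nonneg (by positivity)]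
    calc _ ≤ γ ^ n * (rmax * ((n + 1) * G)) := by
          gcongr; exact norm_rewardGrad_le hr hrmax hπ hG n θ
      _ = _ := by ring
  -- Termwise differentiation: the bound `hb` on the gradients is summable and uniform in `θ`.
  have h := hasFDerivAt_tsum (x₀ := θ) hs (𝕜 := ℝ)
    (f := fun n θ => γ ^ n * ∫ τ, N.reward τ n ∂(N.trajLaw s₀ a₀ (π θ)))
    (f' := fun n θ => InnerProductSpace.toDual ℝ _ (γ ^ n • N.rewardGrad s₀ a₀ π n θ))
    (fun n θ => ?_) (fun n θ => by rw [LinearIsometryEquiv.norm_map]; exact hb n θ) ?_ θ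
  · rw [hasGradientAt_iff_hasFDerivAt, funext (objective_eq_tsum hγ₀ hγ₁ hr)]
    convert! h using 1
    exact (InnerProductSpace.toDual ℝ (EuclideanSpace ℝ (Fin d))).toContinuousLinearEquiv.map_tsum
  · have := hasGradientAt_iff_hasFDerivAt.1
      (hasGradientAt_expectedReward (N := N) (s₀ := s₀) (a₀ := a₀) hπ n θ)
    rw [map_smul]
    exact this.const_mul _
  · refine Summable.of_norm_bounded (g := fun n => γ ^ n * rmax)
      ((summable_geometric_of_lt_one hγ₀ hγ₁).mul_right _) fun n => ?_
    rw [norm_mul, Real.norm_of_nonneg (by positivity)]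
    refine mul_le_mul_of_nonneg_left ?_ (by positivity)
    simpa using norm_integral_le_of_norm_le_const (μ := N.trajLaw s₀ a₀ (π θ))
      (f := fun τ => N.reward τ n) (Filter.Eventually.of_forall fun τ => abs_reward_le hr τ n)

lemma summable_rewardGrad (hγ₀ : 0 ≤ γ) (hγ₁ : γ < 1)
    (hr : ∀ t, 1 ≤ t → ∀ o a, |N.r t o a| ≤ rmax) (hrmax : 0 ≤ rmax)
    (hπ : IsRegularASM π G M) (hG : 0 ≤ G) (θ : EuclideanSpace ℝ (Fin d)) :
    Summable fun n => γ ^ n • N.rewardGrad s₀ a₀ π n θ := by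
  refine Summable.of_norm_bounded
    ((hasSum_succ_mul_geometric hγ₀ hγ₁).summable.mul_right (rmax * G)) fun n => ?_
  rw [norm_smul, Real.norm_of_nonneg (by positivity)]
  calc _ ≤ γ ^ n * (rmax * ((n + 1) * G)) := by
        gcongr; exact norm_rewardGrad_le hr hrmax hπ hG n θ
    _ = _ := by ring

/-- Smoothness of the objective. -/
lemma norm_gradient_objective_sub_le (hγ₀ : 0 ≤ γ) (hγ₁ : γ < 1)
    (hr : ∀ t, 1 ≤ t → ∀ o a, |N.r t o a| ≤ rmax) (hrmax : 0 ≤ rmax)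
    (hπ : IsRegularASM π G M) (hG : 0 ≤ G) (hM : 0 ≤ M) (θ θ' : EuclideanSpace ℝ (Fin d)) :
    ‖∇ (N.objective γ s₀ a₀ π) θ' - ∇ (N.objective γ s₀ a₀ π) θ‖ ≤
      rmax / (1 - γ) ^ 2 * (M + G ^ 2 * (1 + γ) / (1 - γ)) * ‖θ' - θ‖ := by
  rw [(hasGradientAt_objective hγ₀ hγ₁ hr hrmax hπ hG θ).gradient,
    (hasGradientAt_objective hγ₀ hγ₁ hr hrmax hπ hG θ').gradient,
    ← (summable_rewardGrad hγ₀ hγ₁ hr hrmax hπ hG θ').tsum_sub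
      (summable_rewardGrad hγ₀ hγ₁ hr hrmax hπ hG θ)]
  -- The G² part sums to (1+γ)/(1-γ)³ and the M part to 1/(1-γ)², which together form β.
  have h := (((hasSum_succ_sq_mul_geometric hγ₀ hγ₁).mul_right (G ^ 2)).add
    ((hasSum_succ_mul_geometric hγ₀ hγ₁).mul_right M)).mul_right (rmax * ‖θ' - θ‖)
  refine tsum_of_norm_bounded (g := fun n : ℕ => γ ^ n *
    (rmax * ((n + 1) ^ 2 * G ^ 2 + (n + 1) * M) * ‖θ' - θ‖)) ?_ fun n => ?_
  · have h1 : 1 - γ ≠ 0 := (sub_pos.2 hγ₁).ne'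
    convert! h using 1
    · funext n
      ring
    · field_simp
      ring
  · rw [← smul_sub, norm_smul, Real.norm_of_nonneg (by positivity)]
    gcongr
    exact norm_rewardGrad_sub_le hr hrmax hπ hG hM n θ θ'

/-- The gradient estimate is unbiased. -/
lemma integral_gradEst (hγ₀ : 0 ≤ γ) (hγ₁ : γ < 1)
    (hr : ∀ t, 1 ≤ t → ∀ o a, |N.r t o a| ≤ rmax) (hrmax : 0 ≤ rmax)
    (hπ : IsRegularASM π G M) (hG : 0 ≤ G) (θ : EuclideanSpace ℝ (Fin d)) :
    ∫ τ, N.gradEst γ s₀ a₀ π θ τ ∂(N.trajLaw s₀ a₀ (π θ)) = ∇ (N.objective γ s₀ a₀ π) θ := by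
  rw [(hasGradientAt_objective hγ₀ hγ₁ hr hrmax hπ hG θ).gradient]
  simp only [gradEst_eq_tsum hγ₀ hγ₁ hr hrmax hπ hG θ]
  have hb : ∀ (n : ℕ) (τ : Traj O S A), ‖γ ^ n • (N.reward τ n • scoreSum s₀ a₀ π θ τ n)‖ ≤
      γ ^ n * ((n : ℝ) + 1) * (rmax * G) := fun n τ => by
    rw [norm_smul, Real.norm_of_nonneg (by positivity)]
    calc _ ≤ γ ^ n * (rmax * ((n + 1) * G)) := by
          gcongr; exact norm_reward_smul_scoreSum_le hr hrmax hπ hG θ τ n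
      _ = _ := by ring
  have h := hasSum_integral_of_summable_integral_norm (μ := N.trajLaw s₀ a₀ (π θ))
    (F := fun (n : ℕ) τ => γ ^ n • (N.reward τ n • scoreSum s₀ a₀ π θ τ n)) (fun n => ?_) ?_
  · rw [← h.tsum_eq]
    exact tsum_congr fun n => integral_smul _ _
  · exact Integrable.of_bound (((measurable_reward N n).smul
      (measurable_scoreSum s₀ a₀ π θ n)).const_smul (γ ^ n)).aestronglyMeasurable _
      (Filter.Eventually.of_forall (hb n))
  · refine Summable.of_norm_bounded
      ((hasSum_succ_mul_geometric hγ₀ hγ₁).summable.mul_right (rmax * G)) fun n => ?_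
    simpa using norm_integral_le_of_norm_le_const (μ := N.trajLaw s₀ a₀ (π θ))
      (f := fun τ => ‖γ ^ n • (N.reward τ n • scoreSum s₀ a₀ π θ τ n)‖)
      (Filter.Eventually.of_forall fun τ => by rw [norm_norm]; exact hb n τ)

end Law

end NMDP

/-! ### Measurability in the parameter, and conditioning on the history -/

lemma measurable_history {Ω X : Type*} [MeasurableSpace X] (τ : ℕ → Ω → X) {j k : ℕ} (h : j < k) :
    Measurable[⨆ j : Fin k, MeasurableSpace.comap (τ j) inferInstance] (τ j) :=
  measurable_iff_comap_le.2 <|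
    le_iSup (fun j : Fin k => MeasurableSpace.comap (τ j) inferInstance) ⟨j, h⟩

namespace NMDP

variable {O S A : Type*} {d : ℕ} {N : NMDP O A} {γ rmax G M : ℝ} {s₀ : S} {a₀ : A}
  {π : EuclideanSpace ℝ (Fin d) → ASMKernel O S A}
  [Fintype O] [Fintype S] [Fintype A]
  [MeasurableSpace O] [MeasurableSpace S] [MeasurableSpace A]
  [MeasurableSingletonClass O] [MeasurableSingletonClass S] [MeasurableSingletonClass A]

/-- Cylinders form a generating π-system, and the mass of a cylinder is a finite sum of path
probabilities, which are differentiable and hence continuous in `θ`. -/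
lemma measurable_trajLaw (N : NMDP O A) (s₀ : S) (a₀ : A) (hπ : IsRegularASM π G M) :
    Measurable fun θ => N.trajLaw s₀ a₀ (π θ) := by
  refine Measurable.measure_of_isPiSystem_of_isProbabilityMeasure
    generateFrom_measurableCylinders.symm isPiSystem_measurableCylinders fun B hB => ?_
  have hBm := MeasurableSet.of_mem_measurableCylinders hB
  obtain ⟨I, T, -, rfl⟩ := (mem_measurableCylinders B).1 hB
  have hcongr : ∀ τ τ' : Traj O S A, (∀ i ≤ I.sup id, τ i = τ' i) →
      (cylinder I T).indicator (fun _ => (1 : ℝ)) τ =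
        (cylinder I T).indicator (fun _ => (1 : ℝ)) τ' := fun τ τ' h => by
    have h1 : I.restrict τ = I.restrict τ' :=
      funext fun i => h i (Finset.le_sup (f := id) i.2)
    have h2 : τ ∈ cylinder I T ↔ τ' ∈ cylinder I T := iff_of_eq (congrArg (· ∈ T) h1)
    by_cases hτ : τ ∈ cylinder I T
    · rw [Set.indicator_of_mem hτ, Set.indicator_of_mem (h2.1 hτ)]
    · rw [Set.indicator_of_notMem hτ, Set.indicator_of_notMem (mt h2.2 hτ)]
  have h : ∀ θ, N.trajLaw s₀ a₀ (π θ) (cylinder I T) =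
      ENNReal.ofReal (∑ h, N.prefixProb s₀ a₀ (π θ) (I.sup id) h •
        (cylinder I T).indicator (fun _ => (1 : ℝ)) (prefixExt (I.sup id) h)) := fun θ => by
    rw [← N.integral_eq_sum_prefixProb s₀ a₀ (π θ) hcongr, integral_indicator_const _ hBm]
    simp
  simp only [h]
  refine (Finset.measurable_fun_sum _ fun h _ => ?_).ennreal_ofReal
  have hc : Continuous fun θ => N.prefixProb s₀ a₀ (π θ) (I.sup id) h :=
    continuous_iff_continuousAt.2 fun θ => (N.hasGradientAt_prefixProb s₀ a₀ hπ θ _ h).continuousAt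
  exact hc.measurable.smul_const _

/-- The law of the trajectory as a Markov kernel in the parameter. -/
noncomputable def trajKernel (N : NMDP O A) (s₀ : S) (a₀ : A) (hπ : IsRegularASM π G M) :
    ProbabilityTheory.Kernel (EuclideanSpace ℝ (Fin d)) (Traj O S A) :=
  ⟨fun θ => N.trajLaw s₀ a₀ (π θ), measurable_trajLaw N s₀ a₀ hπ⟩

instance (hπ : IsRegularASM π G M) :
    ProbabilityTheory.IsMarkovKernel (N.trajKernel s₀ a₀ hπ) :=
  ⟨fun θ => isProbabilityMeasure_trajLaw N s₀ a₀ (π θ)⟩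

/-- The trajectory enters only through a countable discrete prefix, so measurability in `θ` for each
prefix is enough. -/
lemma measurable_scoreSum_uncurry (s₀ : S) (a₀ : A) (hπ : IsRegularASM π G M) (n : ℕ) :
    Measurable fun p : EuclideanSpace ℝ (Fin d) × Traj O S A => scoreSum s₀ a₀ π p.1 p.2 n := by
  have h : (fun p : EuclideanSpace ℝ (Fin d) × Traj O S A => scoreSum s₀ a₀ π p.1 p.2 n) =
      (fun q : EuclideanSpace ℝ (Fin d) × (Finset.Iic n → O × S × A) =>
        scoreSum s₀ a₀ π q.1 (prefixExt n q.2) n) ∘ Prod.map id (truncate n) :=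
    funext fun p => scoreSum_congr _ _ _ _ fun i hi => (prefixExt_truncate hi p.2).symm
  rw [h]
  refine Measurable.comp (measurable_from_prod_countable_left fun h => ?_)
    (measurable_id.prodMap (measurable_truncate n))
  exact (differentiable_scoreSum hπ s₀ a₀ (prefixExt n h) n).continuous.measurable

lemma measurable_gradEst (hγ₀ : 0 ≤ γ) (hγ₁ : γ < 1)
    (hr : ∀ t, 1 ≤ t → ∀ o a, |N.r t o a| ≤ rmax) (hrmax : 0 ≤ rmax)
    (hπ : IsRegularASM π G M) (hG : 0 ≤ G) :
    Measurable fun p : EuclideanSpace ℝ (Fin d) × Traj O S A =>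
      N.gradEst γ s₀ a₀ π p.1 p.2 := by
  have hs : ∀ p : EuclideanSpace ℝ (Fin d) × Traj O S A, Summable fun n =>
      γ ^ n • (N.reward p.2 n • scoreSum s₀ a₀ π p.1 p.2 n) := fun p => by
    refine Summable.of_norm_bounded
      ((hasSum_succ_mul_geometric hγ₀ hγ₁).summable.mul_right (rmax * G)) fun n => ?_
    rw [norm_smul, Real.norm_of_nonneg (by positivity)]
    calc _ ≤ γ ^ n * (rmax * ((n + 1) * G)) := by
          gcongr; exact norm_reward_smul_scoreSum_le hr hrmax hπ hG p.1 p.2 n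
      _ = _ := by ring
  simp only [gradEst_eq_tsum hγ₀ hγ₁ hr hrmax hπ hG]
  refine measurable_of_tendsto_metrizable (fun n => ?_)
    (tendsto_pi_nhds.2 fun p => (hs p).hasSum.tendsto_sum_nat)
  exact Finset.measurable_fun_sum _ fun i _ => (((measurable_reward N i).comp measurable_snd).smul
    (measurable_scoreSum_uncurry s₀ a₀ hπ i)).const_smul (γ ^ i)

/-- The σ-algebra on `Ω` is arbitrary and only episodes before `k` are used, so the lemma also
applies to the σ-algebra of the history. -/
lemma measurable_iterate {α : ℕ → ℝ} {θ₁ : EuclideanSpace ℝ (Fin d)} {Ω : Type*}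
    {mΩ : MeasurableSpace Ω} {τ : ℕ → Ω → Traj O S A} (hγ₀ : 0 ≤ γ) (hγ₁ : γ < 1)
    (hr : ∀ t, 1 ≤ t → ∀ o a, |N.r t o a| ≤ rmax) (hrmax : 0 ≤ rmax)
    (hπ : IsRegularASM π G M) (hG : 0 ≤ G) {k : ℕ}
    (hτ : ∀ j < k, Measurable (τ j)) :
    Measurable fun ω => N.iterate γ s₀ a₀ π α θ₁ (fun j => τ j ω) k := by
  induction k with
  | zero => exact measurable_const
  | succ k ih =>
    have h := ih fun j hj => hτ j (hj.trans k.lt_succ_self)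
    exact h.add (((measurable_gradEst hγ₀ hγ₁ hr hrmax hπ hG).comp
      (h.prodMk (hτ k k.lt_succ_self))).const_smul (α k))

section Run

variable {α : ℕ → ℝ} {θ₁ : EuclideanSpace ℝ (Fin d)} {Ω : Type*} [mΩ : MeasurableSpace Ω]
  {P : Measure Ω} {τ : ℕ → Ω → Traj O S A}

lemma IsASMPGRun.history_le (hrun : N.IsASMPGRun γ s₀ a₀ π α θ₁ P τ) (k : ℕ) :
    ⨆ j : Fin k, MeasurableSpace.comap (τ j) inferInstance ≤ mΩ :=
  iSup_le fun j => (hrun.measurable j).comap_le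

/-- Joint law of a statistic of the history that determines the current parameter and of the
trajectory of the current episode. -/
lemma IsASMPGRun.map_prodMk [IsProbabilityMeasure P] (hrun : N.IsASMPGRun γ s₀ a₀ π α θ₁ P τ)
    (hπ : IsRegularASM π G M) {k : ℕ} {Y : Type*} [MeasurableSpace Y] {Z : Ω → Y}
    (hZ : Measurable[⨆ j : Fin k, MeasurableSpace.comap (τ j) inferInstance] Z)
    {φ : Y → EuclideanSpace ℝ (Fin d)} (hφ : Measurable φ)
    (hφZ : ∀ ω, φ (Z ω) = N.iterate γ s₀ a₀ π α θ₁ (fun j => τ j ω) k) :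
    P.map (fun ω => (Z ω, τ k ω)) = P.map Z ⊗ₘ (N.trajKernel s₀ a₀ hπ).comap φ hφ := by
  have hle := hrun.history_le k
  have hZ' : Measurable Z := hZ.mono hle le_rfl
  have hZτ := hZ'.prodMk (hrun.measurable k)
  have : IsProbabilityMeasure (P.map Z) := Measure.isProbabilityMeasure_map hZ'.aemeasurable
  have : IsProbabilityMeasure (P.map fun ω => (Z ω, τ k ω)) :=
    Measure.isProbabilityMeasure_map hZτ.aemeasurable
  refine Measure.ext_prod fun {C B} hC hB => ?_
  have hκ : Measurable fun z => N.trajLaw s₀ a₀ (π (φ z)) B :=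
    (Measure.measurable_coe hB).comp ((measurable_trajLaw N s₀ a₀ hπ).comp hφ)
  rw [Measure.compProd_apply_prod hC hB, Measure.map_apply hZτ (hC.prod hB)]
  change P (Z ⁻¹' C ∩ τ k ⁻¹' B) = ∫⁻ z in C, N.trajLaw s₀ a₀ (π (φ z)) B ∂(P.map Z)
  rw [setLIntegral_map hC hκ hZ']
  have hfin : ∫⁻ ω in Z ⁻¹' C, N.trajLaw s₀ a₀ (π (φ (Z ω))) B ∂P ≠ ⊤ :=
    ((lintegral_mono fun _ => prob_le_one).trans_lt (by simp)).ne
  have h0 := integral_toReal (μ := P.restrict (Z ⁻¹' C))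
    (f := fun ω => N.trajLaw s₀ a₀ (π (φ (Z ω))) B) (hκ.comp hZ').aemeasurable
      (Filter.Eventually.of_forall fun _ => measure_lt_top _ _)
  rw [← ENNReal.toReal_eq_toReal_iff' (measure_ne_top _ _) hfin, ← h0]
  -- The event `Z ⁻¹' C` belongs to the history, so integrating the conditional probability over it
  -- gives the mass of the rectangle `C ×ˢ B`.
  have h1 := setIntegral_condExp (μ := P) hle
    (f := (τ k ⁻¹' B).indicator fun _ => (1 : ℝ))
    ((integrable_const _).indicator (hrun.measurable k hB)) (hZ hC)
  rw [setIntegral_indicator (hrun.measurable k hB)] at h1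
  have h2 := setIntegral_congr_ae (μ := P) (hZ' hC) ((hrun.condLaw k B hB).mono fun ω h _ => h)
  rw [h2] at h1
  simp only [← hφZ] at h1
  refine Eq.trans ?_ h1.symm
  simp [Measure.real]

/-- The tower property with the history frozen. This nonnegative form serves the exponential
moments; the bounded form `integral_eq` serves unbiasedness. -/
lemma IsASMPGRun.lintegral_eq [IsProbabilityMeasure P] (hrun : N.IsASMPGRun γ s₀ a₀ π α θ₁ P τ)
    (hπ : IsRegularASM π G M) {k : ℕ} {Y : Type*} [MeasurableSpace Y] {Z : Ω → Y}
    (hZ : Measurable[⨆ j : Fin k, MeasurableSpace.comap (τ j) inferInstance] Z)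
    {φ : Y → EuclideanSpace ℝ (Fin d)} (hφ : Measurable φ)
    (hφZ : ∀ ω, φ (Z ω) = N.iterate γ s₀ a₀ π α θ₁ (fun j => τ j ω) k)
    {f : Y × Traj O S A → ENNReal} (hf : Measurable f) :
    ∫⁻ ω, f (Z ω, τ k ω) ∂P = ∫⁻ ω, ∫⁻ x, f (Z ω, x) ∂(N.trajLaw s₀ a₀ (π (φ (Z ω)))) ∂P := by
  have hZ' : Measurable Z := hZ.mono (hrun.history_le k) le_rfl
  have : IsProbabilityMeasure (P.map Z) := Measure.isProbabilityMeasure_map hZ'.aemeasurable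
  rw [← lintegral_map hf (hZ'.prodMk (hrun.measurable k)), hrun.map_prodMk hπ hZ hφ hφZ,
    Measure.lintegral_compProd hf, lintegral_map _ hZ']
  · rfl
  · exact hf.lintegral_kernel_prod_right'

lemma IsASMPGRun.integral_eq [IsProbabilityMeasure P] (hrun : N.IsASMPGRun γ s₀ a₀ π α θ₁ P τ)
    (hπ : IsRegularASM π G M) {k : ℕ} {Y : Type*} [MeasurableSpace Y] {Z : Ω → Y}
    (hZ : Measurable[⨆ j : Fin k, MeasurableSpace.comap (τ j) inferInstance] Z)
    {φ : Y → EuclideanSpace ℝ (Fin d)} (hφ : Measurable φ)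
    (hφZ : ∀ ω, φ (Z ω) = N.iterate γ s₀ a₀ π α θ₁ (fun j => τ j ω) k)
    {f : Y × Traj O S A → ℝ} (hf : Measurable f) {c : ℝ} (hc : ∀ p, ‖f p‖ ≤ c) :
    ∫ ω, f (Z ω, τ k ω) ∂P = ∫ ω, ∫ x, f (Z ω, x) ∂(N.trajLaw s₀ a₀ (π (φ (Z ω)))) ∂P := by
  have hZ' : Measurable Z := hZ.mono (hrun.history_le k) le_rfl
  have : IsProbabilityMeasure (P.map Z) := Measure.isProbabilityMeasure_map hZ'.aemeasurable
  have h := hf.stronglyMeasurable.integral_kernel_prod_right'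
    (κ := (N.trajKernel s₀ a₀ hπ).comap φ hφ)
  rw [← integral_map (hZ'.prodMk (hrun.measurable k)).aemeasurable hf.aestronglyMeasurable,
    hrun.map_prodMk hπ hZ hφ hφZ, Measure.integral_compProd (Integrable.of_bound
      hf.aestronglyMeasurable c (Filter.Eventually.of_forall hc)),
    integral_map hZ'.aemeasurable h.aestronglyMeasurable]
  rfl

end Run

end NMDP

/-! ### Two deterministic lemmas on gradient ascent -/

section Ascent

variable {E : Type*} [NormedAddCommGroup E] [InnerProductSpace ℝ E] [CompleteSpace E]

/-- The quadratic lower bound for a function with Lipschitz gradient. -/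
lemma add_inner_gradient_sub_le {J : E → ℝ} {β : ℝ} (hJ : Differentiable ℝ J)
    (hL : ∀ x y, ‖∇ J y - ∇ J x‖ ≤ β * ‖y - x‖) (x v : E) :
    J x + inner ℝ (∇ J x) v - β / 2 * ‖v‖ ^ 2 ≤ J (x + v) := by
  -- The claim is φ(0) ≤ φ(1). The quadratic term compensates the variation of the gradient, so φ' ≥
  -- 0 on (0, 1) by Cauchy–Schwarz.
  let φ : ℝ → ℝ := fun t => J (x + t • v) - t * inner ℝ (∇ J x) v + β / 2 * ‖v‖ ^ 2 * t ^ 2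
  have hφ : ∀ t, HasDerivAt φ (inner ℝ (∇ J (x + t • v) - ∇ J x) v + β * ‖v‖ ^ 2 * t) t := by
    intro t
    have h1 : HasDerivAt (fun t : ℝ => x + t • v) v t := by
      simpa using ((hasDerivAt_id t).smul_const v).const_add x
    have h2 := (hJ (x + t • v)).hasGradientAt.hasFDerivAt.comp_hasDerivAt t h1
    convert! (h2.sub ((hasDerivAt_id t).mul_const (inner ℝ (∇ J x) v))).add
      ((hasDerivAt_pow 2 t).const_mul (β / 2 * ‖v‖ ^ 2)) using 1
    rw [inner_sub_left, InnerProductSpace.toDual_apply_apply]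
    push_cast
    ring
  have hmono : MonotoneOn φ (Set.Icc 0 1) := by
    refine monotoneOn_of_deriv_nonneg (convex_Icc 0 1)
      (fun t _ => (hφ t).continuousAt.continuousWithinAt)
      (fun t _ => (hφ t).differentiableAt.differentiableWithinAt) fun t ht => ?_
    rw [interior_Icc] at ht
    rw [(hφ t).deriv]
    have h1 := hL x (x + t • v)
    rw [add_sub_cancel_left, norm_smul, Real.norm_of_nonneg ht.1.le] at h1
    have h2 := neg_le_of_abs_le (abs_real_inner_le_norm (∇ J (x + t • v) - ∇ J x) v)
    nlinarith [mul_le_mul_of_nonneg_right h1 (norm_nonneg v)]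
  have h := hmono (Set.left_mem_Icc.2 zero_le_one) (Set.right_mem_Icc.2 zero_le_one) zero_le_one
  simp only [φ, zero_smul, add_zero, zero_mul, sub_zero, one_smul, one_mul] at h
  linarith

end Ascent

/-- A nonnegative sequence with increments `O(α)` and `∑ α a² < ∞` vanishes in the limit under
the Robbins–Monro conditions: its cubes form a Cauchy sequence. -/
lemma tendsto_zero_of_summable_mul_sq {α a : ℕ → ℝ} {L : ℝ} (hα : ∀ k, 0 < α k)
    (hsum : Filter.Tendsto (fun n => ∑ k ∈ Finset.range n, α k) Filter.atTop Filter.atTop)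
    (hsq : Summable fun k => α k ^ 2) (ha : ∀ k, 0 ≤ a k)
    (hinc : ∀ k, |a (k + 1) - a k| ≤ L * α k) (hs : Summable fun k => α k * a k ^ 2) :
    Filter.Tendsto a Filter.atTop (nhds 0) := by
  have hL : 0 ≤ L := nonneg_of_mul_nonneg_left ((abs_nonneg _).trans (hinc 0)) (hα 0)
  set T := ∑' k, α k ^ 2 with hT
  -- Needed only to dominate α³ by a multiple of the summable α².
  have hαT : ∀ k, α k ≤ 1 + T := fun k => by
    have := hsq.le_tsum k fun j _ => sq_nonneg _
    nlinarith [sq_nonneg (α k - 1), sq_nonneg (α k)]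
  have hcub : Summable fun k => 5 * L * (α k * a k ^ 2) + 3 * L ^ 3 * ((1 + T) * α k ^ 2) :=
    (hs.mul_left _).add ((hsq.mul_left _).mul_left _)
  -- Cubes are used because their first-order increment is of size α a², which is summable by
  -- hypothesis.
  have hdist : ∀ k, dist (a k ^ 3) (a (k + 1) ^ 3) ≤
      5 * L * (α k * a k ^ 2) + 3 * L ^ 3 * ((1 + T) * α k ^ 2) := fun k => by
    have hk := hinc k
    set h := a (k + 1) - a k with hh
    have h1 : a (k + 1) = a k + h := by rw [hh]; ring
    have h2 : 3 * a k ^ 2 + 3 * a k * h + h ^ 2 ≤ 5 * a k ^ 2 + 3 * h ^ 2 := by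
      nlinarith [sq_nonneg (a k - h)]
    have h3 : 0 ≤ 3 * a k ^ 2 + 3 * a k * h + h ^ 2 := by
      nlinarith [sq_nonneg (3 * a k + 2 * h), sq_nonneg (a k), sq_nonneg h]
    have h4 : h ^ 2 ≤ (L * α k) ^ 2 := sq_le_sq' (by linarith [neg_le_of_abs_le hk])
      (le_of_abs_le hk)
    rw [dist_comm, Real.dist_eq, h1,
      show (a k + h) ^ 3 - a k ^ 3 = h * (3 * a k ^ 2 + 3 * a k * h + h ^ 2) by ring,
      abs_mul, abs_of_nonneg h3]
    calc |h| * (3 * a k ^ 2 + 3 * a k * h + h ^ 2)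
        ≤ (L * α k) * (5 * a k ^ 2 + 3 * (L * α k) ^ 2) :=
          mul_le_mul hk (by linarith) h3 (mul_nonneg hL (hα k).le)
      _ = 5 * L * (α k * a k ^ 2) + 3 * L ^ 3 * (α k * α k ^ 2) := by ring
      _ ≤ _ := by gcongr; exact hαT k
  obtain ⟨ℓ, hℓ⟩ := cauchySeq_tendsto_of_complete
    (cauchySeq_of_dist_le_of_summable _ hdist hcub)
  have hℓ0 : 0 ≤ ℓ := ge_of_tendsto' hℓ fun k => pow_nonneg (ha k) 3
  have hzero : ℓ = 0 := by
    by_contra hne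
    have hpos : 0 < ℓ := lt_of_le_of_ne hℓ0 (Ne.symm hne)
    -- Once a³ > ℓ/2, either a ≥ 1, or a² ≥ a³ > ℓ/2. So a² is eventually bounded below, and `hs`
    -- would make `α` summable.
    have hc : 0 < min 1 (ℓ / 2) := by positivity
    have hev : ∀ᶠ k in Filter.atTop, ‖α k‖ ≤ (min 1 (ℓ / 2))⁻¹ * (α k * a k ^ 2) := by
      filter_upwards [hℓ.eventually_const_lt (half_lt_self hpos)] with k hk
      have h1 : min 1 (ℓ / 2) ≤ a k ^ 2 := by
        rcases le_total 1 (a k) with h | h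
        · exact (min_le_left _ _).trans (one_le_pow₀ h)
        · exact (min_le_right _ _).trans
            (hk.le.trans (pow_le_pow_of_le_one (ha k) h (by norm_num)))
      rw [Real.norm_of_nonneg (hα k).le, inv_mul_eq_div, le_div_iff₀ hc]
      exact mul_le_mul_of_nonneg_left h1 (hα k).le
    have hS : Summable α := Summable.of_norm_bounded_eventually_nat (hs.mul_left _) hev
    exact (not_summable_iff_tendsto_nat_atTop_of_nonneg fun k => (hα k).le).2 hsum hS
  rw [hzero] at hℓ
  refine Metric.tendsto_atTop.2 fun ε hε => ?_
  obtain ⟨n, hn⟩ := Metric.tendsto_atTop.1 hℓ (ε ^ 3) (by positivity)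
  refine ⟨n, fun k hk => ?_⟩
  have h := hn k hk
  rw [Real.dist_eq, sub_zero, abs_of_nonneg (pow_nonneg (ha k) 3)] at h
  rw [Real.dist_eq, sub_zero, abs_of_nonneg (ha k)]
  exact lt_of_pow_lt_pow_left₀ 3 hε.le h

/-! ### Abstract stochastic gradient ascent -/

/-- Stochastic gradient ascent on a function `J` with `β`-Lipschitz gradient, with gradient
estimates bounded by `D` whose noise is unbiased and conditionally sub-Gaussian. -/
structure IsStochasticAscent {E : Type*} [NormedAddCommGroup E] [InnerProductSpace ℝ E]
    [CompleteSpace E] [MeasurableSpace E] {Ω : Type*} [MeasurableSpace Ω] (P : Measure Ω)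
    (J : E → ℝ) (β D : ℝ) (α : ℕ → ℝ) (θ₁ : E) (θ g : ℕ → Ω → E) : Prop where
  differentiable : Differentiable ℝ J
  bddAbove : BddAbove (Set.range J)
  norm_gradient_sub_le : ∀ x y, ‖∇ J y - ∇ J x‖ ≤ β * ‖y - x‖
  norm_gradient_le : ∀ x, ‖∇ J x‖ ≤ D
  norm_estimate_le : ∀ k ω, ‖g k ω‖ ≤ D
  zero : ∀ ω, θ 0 ω = θ₁
  succ : ∀ k ω, θ (k + 1) ω = θ k ω + α k • g k ω
  measurable_iterate : ∀ k, Measurable (θ k)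
  measurable_estimate : ∀ k, Measurable (g k)
  unbiased : ∀ k, ∫ ω, inner ℝ (∇ J (θ k ω)) (g k ω) ∂P = ∫ ω, ‖∇ J (θ k ω)‖ ^ 2 ∂P
  subgaussian : ∀ (K : ℕ) (l : ℝ), ∫⁻ ω, ENNReal.ofReal (Real.exp (∑ k ∈ Finset.range K,
    (l * (α k * (‖∇ J (θ k ω)‖ ^ 2 - inner ℝ (∇ J (θ k ω)) (g k ω))) -
      l ^ 2 * D ^ 2 / 2 * (α k ^ 2 * ‖∇ J (θ k ω)‖ ^ 2)))) ∂P ≤ 1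

namespace IsStochasticAscent

variable {E : Type*} [NormedAddCommGroup E] [InnerProductSpace ℝ E]
    [CompleteSpace E] [MeasurableSpace E] {Ω : Type*} [MeasurableSpace Ω] {P : Measure Ω}
    {J : E → ℝ} {β D : ℝ} {α : ℕ → ℝ} {θ₁ : E} {θ g : ℕ → Ω → E}

lemma continuous_gradient (h : IsStochasticAscent P J β D α θ₁ θ g) : Continuous (∇ J) :=
  (LipschitzWith.of_dist_le_mul (K := Real.toNNReal β) fun y x => by
    rw [dist_eq_norm, dist_eq_norm]
    exact (h.norm_gradient_sub_le x y).trans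
      (mul_le_mul_of_nonneg_right (Real.le_coe_toNNReal β) (norm_nonneg _))).continuous

/-- Telescoped ascent along a sample path. -/
lemma sum_inner_le (h : IsStochasticAscent P J β D α θ₁ θ g) (hβ : 0 ≤ β) (K : ℕ) (ω : Ω) :
    ∑ k ∈ Finset.range K, α k * inner ℝ (∇ J (θ k ω)) (g k ω) ≤
      ((⨆ x, J x) - J θ₁) + β * D ^ 2 / 2 * ∑ k ∈ Finset.range K, α k ^ 2 := by
  have key : ∑ k ∈ Finset.range K, α k * inner ℝ (∇ J (θ k ω)) (g k ω) ≤
      (J (θ K ω) - J θ₁) + β * D ^ 2 / 2 * ∑ k ∈ Finset.range K, α k ^ 2 := by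
    induction K with
    | zero => simp [h.zero ω]
    | succ K ih =>
      rw [Finset.sum_range_succ, Finset.sum_range_succ, mul_add]
      have h1 := add_inner_gradient_sub_le h.differentiable h.norm_gradient_sub_le
        (θ K ω) (α K • g K ω)
      rw [← h.succ, inner_smul_right, norm_smul, mul_pow, Real.norm_eq_abs, sq_abs] at h1
      have h2 : ‖g K ω‖ ^ 2 ≤ D ^ 2 :=
        pow_le_pow_left₀ (norm_nonneg _) (h.norm_estimate_le K ω) 2
      have h3 : β / 2 * (α K ^ 2 * ‖g K ω‖ ^ 2) ≤ β / 2 * (α K ^ 2 * D ^ 2) := by gcongr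
      linarith
  have := le_ciSup h.bddAbove (θ K ω)
  linarith

variable [BorelSpace E]

lemma measurable_gradient (h : IsStochasticAscent P J β D α θ₁ θ g) (k : ℕ) :
    Measurable fun ω => ∇ J (θ k ω) :=
  h.continuous_gradient.measurable.comp (h.measurable_iterate k)

lemma integrable_sq [IsProbabilityMeasure P] (h : IsStochasticAscent P J β D α θ₁ θ g) (k : ℕ) :
    Integrable (fun ω => ‖∇ J (θ k ω)‖ ^ 2) P :=
  Integrable.of_bound ((h.measurable_gradient k).norm.pow_const 2).aestronglyMeasurable (D ^ 2)
    (Filter.Eventually.of_forall fun ω => by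
      rw [Real.norm_of_nonneg (sq_nonneg _)]
      exact pow_le_pow_left₀ (norm_nonneg _) (h.norm_gradient_le _) 2)

variable [SecondCountableTopology E]

lemma measurable_inner (h : IsStochasticAscent P J β D α θ₁ θ g) (k : ℕ) :
    Measurable fun ω => (inner ℝ (∇ J (θ k ω)) (g k ω) : ℝ) :=
  (h.measurable_gradient k).inner (h.measurable_estimate k)

variable [IsProbabilityMeasure P]

lemma integrable_inner (h : IsStochasticAscent P J β D α θ₁ θ g) (k : ℕ) :
    Integrable (fun ω => (inner ℝ (∇ J (θ k ω)) (g k ω) : ℝ)) P :=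
  Integrable.of_bound (h.measurable_inner k).aestronglyMeasurable (D * D)
    (Filter.Eventually.of_forall fun _ => (norm_inner_le_norm _ _).trans
      (mul_le_mul (h.norm_gradient_le _) (h.norm_estimate_le _ _) (norm_nonneg _)
        ((norm_nonneg _).trans (h.norm_gradient_le θ₁))))

/-- Expectation of `sum_inner_le`, with unbiasedness on the left. Both (a) and (c) rest on it. -/
lemma sum_integral_le (h : IsStochasticAscent P J β D α θ₁ θ g) (hβ : 0 ≤ β) (K : ℕ) :
    ∑ k ∈ Finset.range K, α k * ∫ ω, ‖∇ J (θ k ω)‖ ^ 2 ∂P ≤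
      ((⨆ x, J x) - J θ₁) + β * D ^ 2 / 2 * ∑ k ∈ Finset.range K, α k ^ 2 := by
  have h1 := integral_mono (μ := P) (integrable_finsetSum _ fun k _ =>
    (h.integrable_inner k).const_mul (α k)) (integrable_const _) (h.sum_inner_le hβ K)
  rw [integral_finsetSum _ fun k _ => (h.integrable_inner k).const_mul (α k)] at h1
  simpa only [integral_const_mul, h.unbiased, integral_const, probReal_univ, one_smul] using h1

/-- By Markov's inequality, exp(Y) ≥ 1/δ has probability at most δ. Off this event Y/l < log(1/δ)/l,
and adding `sum_inner_le` gives the displayed bound. The compensator appears as the loss l·D²/2·α²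
in the weights; `l` stays free, to be tuned to the stepsizes. -/
lemma prob_sum_le (h : IsStochasticAscent P J β D α θ₁ θ g) (hβ : 0 ≤ β) (K : ℕ)
    {l δ : ℝ} (hl : 0 < l) (hδ : 0 < δ) {s : Set Ω}
    (hs : ∀ ω, ∑ k ∈ Finset.range K, (α k - l * D ^ 2 / 2 * α k ^ 2) * ‖∇ J (θ k ω)‖ ^ 2 ≤
      ((⨆ x, J x) - J θ₁) + β * D ^ 2 / 2 * ∑ k ∈ Finset.range K, α k ^ 2 +
        Real.log (1 / δ) / l → ω ∈ s) :
    1 - δ ≤ P.real s := by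
  let Y : Ω → ℝ := fun ω => ∑ k ∈ Finset.range K,
    (l * (α k * (‖∇ J (θ k ω)‖ ^ 2 - inner ℝ (∇ J (θ k ω)) (g k ω))) -
      l ^ 2 * D ^ 2 / 2 * (α k ^ 2 * ‖∇ J (θ k ω)‖ ^ 2))
  have hY : Measurable Y := Finset.measurable_fun_sum _ fun k _ =>
    (((((h.measurable_gradient k).norm.pow_const 2).sub (h.measurable_inner k)).const_mul
      _).const_mul _).sub ((((h.measurable_gradient k).norm.pow_const 2).const_mul _).const_mul _)
  have hW : Measurable fun ω => ENNReal.ofReal (Real.exp (Y ω)) := hY.exp.ennreal_ofReal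
  have hm : MeasurableSet {ω | ENNReal.ofReal (1 / δ) ≤ ENNReal.ofReal (Real.exp (Y ω))} :=
    measurableSet_le measurable_const hW
  have hmarkov : P.real {ω | ENNReal.ofReal (1 / δ) ≤ ENNReal.ofReal (Real.exp (Y ω))} ≤ δ := by
    have h1 := mul_meas_ge_le_lintegral (μ := P) hW (ENNReal.ofReal (1 / δ))
    have h2 := ENNReal.toReal_mono ENNReal.one_ne_top (h1.trans (h.subgaussian K l))
    rw [ENNReal.toReal_mul, ENNReal.toReal_ofReal (by positivity), ENNReal.toReal_one,
      div_mul_eq_mul_div, one_mul, div_le_one hδ] at h2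
    exact h2
  have hc := probReal_compl_eq_one_sub (μ := P) hm
  refine (sub_le_sub_left hmarkov 1).trans (hc.symm.le.trans (measureReal_mono fun ω hω => hs ω ?_))
  rw [Set.mem_compl_iff, Set.mem_ofPred_eq, not_le,
    ENNReal.ofReal_lt_ofReal_iff (by positivity), ← Real.lt_log_iff_exp_lt (by positivity)] at hω
  have h1 := h.sum_inner_le hβ K ω
  have h2 : Y ω = l * (∑ k ∈ Finset.range K, (α k - l * D ^ 2 / 2 * α k ^ 2) * ‖∇ J (θ k ω)‖ ^ 2 -
      ∑ k ∈ Finset.range K, α k * inner ℝ (∇ J (θ k ω)) (g k ω)) := by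
    rw [← Finset.sum_sub_distrib, Finset.mul_sum]
    exact Finset.sum_congr rfl fun k _ => by ring
  rw [h2, mul_comm, ← lt_div_iff₀ hl] at hω
  linarith

/-- Tonelli makes ∑ α_k‖∇J(θ_k)‖² finite almost surely. Since the estimates are bounded, ‖∇J(θ_k)‖
moves by at most βDα_k per step, so no martingale convergence is needed. -/
lemma ae_tendsto_norm_gradient (h : IsStochasticAscent P J β D α θ₁ θ g) (hβ : 0 ≤ β)
    (hα : ∀ k, 0 < α k)
    (hsum : Filter.Tendsto (fun n => ∑ k ∈ Finset.range n, α k) Filter.atTop Filter.atTop)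
    (hsq : Summable fun k => α k ^ 2) :
    ∀ᵐ ω ∂P, Filter.Tendsto (fun k => ‖∇ J (θ k ω)‖) Filter.atTop (nhds 0) := by
  have hint : Summable fun k => α k * ∫ ω, ‖∇ J (θ k ω)‖ ^ 2 ∂P := by
    refine summable_of_sum_range_le (c := ((⨆ x, J x) - J θ₁) + β * D ^ 2 / 2 * ∑' k, α k ^ 2)
      (fun k => mul_nonneg (hα k).le (integral_nonneg fun _ => sq_nonneg _)) fun K =>
        (h.sum_integral_le hβ K).trans ?_
    gcongr
    exact hsq.sum_le_tsum _ fun _ _ => sq_nonneg _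
  have hmeas : ∀ k, Measurable fun ω => ENNReal.ofReal (α k * ‖∇ J (θ k ω)‖ ^ 2) := fun k =>
    (((h.measurable_gradient k).norm.pow_const 2).const_mul _).ennreal_ofReal
  have hfin : ∫⁻ ω, ∑' k, ENNReal.ofReal (α k * ‖∇ J (θ k ω)‖ ^ 2) ∂P ≠ ⊤ := by
    rw [lintegral_tsum fun k => (hmeas k).aemeasurable]
    have : ∀ k, ∫⁻ ω, ENNReal.ofReal (α k * ‖∇ J (θ k ω)‖ ^ 2) ∂P =
        ENNReal.ofReal (α k * ∫ ω, ‖∇ J (θ k ω)‖ ^ 2 ∂P) := fun k => by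
      rw [← integral_const_mul, ofReal_integral_eq_lintegral_ofReal
        ((h.integrable_sq k).const_mul _)
        (Filter.Eventually.of_forall fun ω => mul_nonneg (hα k).le (sq_nonneg _))]
    simp only [this]
    exact hint.tsum_ofReal_ne_top
  filter_upwards [ae_lt_top (Measurable.tsum hmeas) hfin] with ω hω
  refine tendsto_zero_of_summable_mul_sq (L := β * D) hα hsum hsq (fun _ => norm_nonneg _)
    (fun k => ?_) ?_
  · refine (abs_norm_sub_norm_le _ _).trans ((h.norm_gradient_sub_le _ _).trans ?_)
    rw [h.succ, add_sub_cancel_left, norm_smul, Real.norm_of_nonneg (hα k).le, mul_assoc,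
      mul_comm D]
    have := (hα k).le
    have := h.norm_estimate_le k ω
    gcongr
  · have := ENNReal.summable_toReal hω.ne
    refine this.congr fun k => ?_
    rw [ENNReal.toReal_ofReal (mul_nonneg (hα k).le (sq_nonneg _))]

end IsStochasticAscent

/-! ### The algorithm as an instance of stochastic ascent -/

/-- Hoeffding's lemma for the linear functional `⟪v, ·⟫` of a bounded random vector of mean `v`. -/
lemma lintegral_exp_inner_le {E X : Type*} [NormedAddCommGroup E] [InnerProductSpace ℝ E]
    [CompleteSpace E] [MeasurableSpace E] [BorelSpace E] [SecondCountableTopology E]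
    [MeasurableSpace X] {μ : Measure X} [IsProbabilityMeasure μ] {f : X → E} (hf : Measurable f)
    {D : ℝ} (hD : ∀ x, ‖f x‖ ≤ D) {v : E} (hv : ∫ x, f x ∂μ = v) (s t : ℝ) :
    ∫⁻ x, ENNReal.ofReal (Real.exp (s + (t * (‖v‖ ^ 2 - inner ℝ v (f x)) -
      t ^ 2 * D ^ 2 / 2 * ‖v‖ ^ 2))) ∂μ ≤ ENNReal.ofReal (Real.exp s) := by
  have hfi : Integrable f μ := Integrable.of_bound hf.aestronglyMeasurable D
    (Filter.Eventually.of_forall hD)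
  have hmean : ∫ x, (inner ℝ v (f x) : ℝ) ∂μ = ‖v‖ ^ 2 := by
    rw [integral_inner hfi, hv, real_inner_self_eq_norm_sq]
  have hmem : ∀ x, (inner ℝ v (f x) : ℝ) ∈ Set.Icc (-(‖v‖ * D)) (‖v‖ * D) := fun x =>
    abs_le.1 ((abs_real_inner_le_norm v (f x)).trans
      (mul_le_mul_of_nonneg_left (hD x) (norm_nonneg v)))
  -- The interval has half-width ‖v‖D, hence variance proxy ‖v‖²D²; its factor ‖v‖² is what later
  -- allows absorption.
  have hsub := ProbabilityTheory.hasSubgaussianMGF_of_mem_Icc (μ := μ)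
    (X := fun x => (inner ℝ v (f x) : ℝ)) (measurable_const.inner hf).aemeasurable
    (Filter.Eventually.of_forall hmem)
  rw [hmean] at hsub
  have heq : ∀ x, Real.exp (s + (t * (‖v‖ ^ 2 - inner ℝ v (f x)) -
      t ^ 2 * D ^ 2 / 2 * ‖v‖ ^ 2)) = Real.exp (s - t ^ 2 * D ^ 2 / 2 * ‖v‖ ^ 2) *
        Real.exp (-t * (inner ℝ v (f x) - ‖v‖ ^ 2)) := fun x => by
    rw [← Real.exp_add]
    ring_nf
  simp only [heq]
  rw [← ofReal_integral_eq_lintegral_ofReal ((hsub.integrable_exp_mul (-t)).const_mul _)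
    (Filter.Eventually.of_forall fun _ => by positivity), integral_const_mul]
  refine ENNReal.ofReal_le_ofReal ?_
  have h := hsub.mgf_le (-t)
  rw [ProbabilityTheory.mgf] at h
  refine (mul_le_mul_of_nonneg_left h (Real.exp_nonneg _)).trans ?_
  rw [← Real.exp_add, Real.exp_le_exp]
  have hc : (((‖‖v‖ * D - -(‖v‖ * D)‖₊ / 2) ^ 2 : NNReal) : ℝ) = (‖v‖ * D) ^ 2 := by
    push_cast
    rw [Real.norm_eq_abs, div_pow, sq_abs]
    ring
  rw [hc]
  exact le_of_eq (by ring)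

namespace NMDP

variable {O S A : Type*} {d : ℕ} {N : NMDP O A} {γ rmax G M : ℝ} {s₀ : S} {a₀ : A}
  {π : EuclideanSpace ℝ (Fin d) → ASMKernel O S A}
  [Fintype O] [Fintype S] [Fintype A]
  [MeasurableSpace O] [MeasurableSpace S] [MeasurableSpace A]
  [MeasurableSingletonClass O] [MeasurableSingletonClass S] [MeasurableSingletonClass A]
  {α : ℕ → ℝ} {θ₁ : EuclideanSpace ℝ (Fin d)} {Ω : Type*} [MeasurableSpace Ω]
  {P : Measure Ω} {τ : ℕ → Ω → Traj O S A}

theorem IsASMPGRun.isStochasticAscent [IsProbabilityMeasure P]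
    (hrun : N.IsASMPGRun γ s₀ a₀ π α θ₁ P τ) (hγ₀ : 0 ≤ γ) (hγ₁ : γ < 1)
    (hr : ∀ t, 1 ≤ t → ∀ o a, |N.r t o a| ≤ rmax) (hrmax : 0 ≤ rmax)
    (hπ : IsRegularASM π G M) (hG : 0 ≤ G) (hM : 0 ≤ M) :
    IsStochasticAscent P (N.objective γ s₀ a₀ π)
      (rmax / (1 - γ) ^ 2 * (M + G ^ 2 * (1 + γ) / (1 - γ))) (rmax * G / (1 - γ) ^ 2) α θ₁
      (fun k ω => N.iterate γ s₀ a₀ π α θ₁ (fun j => τ j ω) k)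
      (fun k ω => N.gradEst γ s₀ a₀ π (N.iterate γ s₀ a₀ π α θ₁ (fun j => τ j ω) k) (τ k ω)) := by
  have hg := measurable_gradEst (s₀ := s₀) (a₀ := a₀) hγ₀ hγ₁ hr hrmax hπ hG
  have hgD := norm_gradEst_le (s₀ := s₀) (a₀ := a₀) hγ₀ hγ₁ hr hrmax hπ hG
  have hgθ : ∀ θ, Measurable (N.gradEst γ s₀ a₀ π θ) := fun θ => hg.comp measurable_prodMk_left
  have hunb := integral_gradEst (s₀ := s₀) (a₀ := a₀) hγ₀ hγ₁ hr hrmax hπ hG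
  have hlip := norm_gradient_objective_sub_le (s₀ := s₀) (a₀ := a₀) hγ₀ hγ₁ hr hrmax hπ hG hM
  have hJD : ∀ θ, ‖∇ (N.objective γ s₀ a₀ π) θ‖ ≤ rmax * G / (1 - γ) ^ 2 := fun θ => by
    rw [← hunb]
    simpa using norm_integral_le_of_norm_le_const (μ := N.trajLaw s₀ a₀ (π θ))
      (Filter.Eventually.of_forall (hgD θ))
  have hJ : Measurable (∇ (N.objective γ s₀ a₀ π)) :=
    (LipschitzWith.of_dist_le_mul (K := Real.toNNReal _) fun y x => by
      rw [dist_eq_norm, dist_eq_norm]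
      exact (hlip x y).trans
        (mul_le_mul_of_nonneg_right (Real.le_coe_toNNReal _) (norm_nonneg _))).continuous.measurable
  have hθ : ∀ k, Measurable fun ω => N.iterate γ s₀ a₀ π α θ₁ (fun j => τ j ω) k := fun k =>
    measurable_iterate hγ₀ hγ₁ hr hrmax hπ hG fun j _ => hrun.measurable j
  refine ⟨fun θ => (hasGradientAt_objective hγ₀ hγ₁ hr hrmax hπ hG θ).differentiableAt,
    ⟨rmax / (1 - γ), ?_⟩, hlip, hJD, fun k ω => hgD _ _, fun ω => rfl, fun k ω => rfl, hθ,
    fun k => hg.comp ((hθ k).prodMk (hrun.measurable k)), fun k => ?_, fun K l => ?_⟩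
  · rintro _ ⟨θ, rfl⟩
    exact (le_abs_self _).trans (abs_objective_le hγ₀ hγ₁ hr θ)
  · have hZ : Measurable[⨆ j : Fin k, MeasurableSpace.comap (τ j) inferInstance]
        fun ω => N.iterate γ s₀ a₀ π α θ₁ (fun j => τ j ω) k :=
      measurable_iterate hγ₀ hγ₁ hr hrmax hπ hG fun j hj => measurable_history τ hj
    have h := hrun.integral_eq hπ hZ measurable_id (fun ω => rfl)
      (f := fun p => inner ℝ (∇ (N.objective γ s₀ a₀ π) p.1) (N.gradEst γ s₀ a₀ π p.1 p.2))
      ((hJ.comp measurable_fst).inner hg)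
      (c := rmax * G / (1 - γ) ^ 2 * (rmax * G / (1 - γ) ^ 2)) (fun p =>
        (norm_inner_le_norm _ _).trans (mul_le_mul (hJD _) (hgD _ _) (norm_nonneg _)
          ((norm_nonneg _).trans (hJD θ₁))))
    refine h.trans (integral_congr_ae (Filter.Eventually.of_forall fun ω => ?_))
    simp only [id]
    rw [integral_inner (Integrable.of_bound (hgθ _).aestronglyMeasurable _
      (Filter.Eventually.of_forall (hgD _))), hunb, real_inner_self_eq_norm_sq]
  -- Supermartingale step: given the first `K` episodes, the last exponential factor has conditional
  -- mean at most 1 by Hoeffding.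
  · induction K with
    | zero => simp
    | succ K ih =>
      refine le_trans ?_ ih
      have hm : ∀ j < K + 1, Measurable[⨆ j : Fin K, MeasurableSpace.comap (τ j) inferInstance]
          fun ω => N.iterate γ s₀ a₀ π α θ₁ (fun j => τ j ω) j := fun j hj =>
        measurable_iterate hγ₀ hγ₁ hr hrmax hπ hG fun i hi =>
          measurable_history τ (hi.trans_le (Nat.lt_succ_iff.1 hj))
      let F : EuclideanSpace ℝ (Fin d) → Traj O S A → ℕ → ℝ := fun θ x k =>
        l * (α k * (‖∇ (N.objective γ s₀ a₀ π) θ‖ ^ 2 -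
          inner ℝ (∇ (N.objective γ s₀ a₀ π) θ) (N.gradEst γ s₀ a₀ π θ x))) -
        l ^ 2 * (rmax * G / (1 - γ) ^ 2) ^ 2 / 2 *
          (α k ^ 2 * ‖∇ (N.objective γ s₀ a₀ π) θ‖ ^ 2)
      have hF : ∀ k, Measurable fun p : EuclideanSpace ℝ (Fin d) × Traj O S A => F p.1 p.2 k :=
        fun k => ((((hJ.comp measurable_fst).norm.pow_const 2).sub
          ((hJ.comp measurable_fst).inner hg)).const_mul _ |>.const_mul _).sub
            (((hJ.comp measurable_fst).norm.pow_const 2).const_mul _ |>.const_mul _)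
      -- The history enters the next factor only through the accumulated exponent and the current
      -- parameter.
      let Z : Ω → ℝ × EuclideanSpace ℝ (Fin d) := fun ω =>
        (∑ k ∈ Finset.range K, F (N.iterate γ s₀ a₀ π α θ₁ (fun j => τ j ω) k) (τ k ω) k,
          N.iterate γ s₀ a₀ π α θ₁ (fun j => τ j ω) K)
      have hZ : Measurable[⨆ j : Fin K, MeasurableSpace.comap (τ j) inferInstance] Z :=
        (Finset.measurable_fun_sum _ fun k hk => (hF k).comp
          ((hm k ((Finset.mem_range.1 hk).trans K.lt_succ_self)).prodMk
            (measurable_history τ (Finset.mem_range.1 hk)))).prodMk (hm K K.lt_succ_self)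
      have h := hrun.lintegral_eq hπ hZ measurable_snd (fun ω => rfl)
        (f := fun p => ENNReal.ofReal (Real.exp (p.1.1 + F p.1.2 p.2 K)))
        ((measurable_fst.comp measurable_fst).add ((hF K).comp
          ((measurable_snd.comp measurable_fst).prodMk measurable_snd))).exp.ennreal_ofReal
      simp only [Finset.sum_range_succ]
      refine h.le.trans (lintegral_mono fun ω => ?_)
      have h1 := lintegral_exp_inner_le (hgθ (Z ω).2) (hgD (Z ω).2) (hunb (Z ω).2) (Z ω).1
        (l * α K)
      refine le_of_eq_of_le (lintegral_congr fun x => ?_) h1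
      simp only [F]
      ring_nf

end NMDP

/-! ### Tuning the stepsizes: rates in expectation and with high probability -/

lemma one_div_min_le {x y : ℝ} (hx : 0 < x) (hy : 0 < y) : 1 / min x y ≤ 1 / x + 1 / y := by
  rcases min_choice x y with h | h <;> rw [h]
  · exact le_add_of_nonneg_right (by positivity)
  · exact le_add_of_nonneg_left (by positivity)

/-- Trade-off between bias and noise for the stepsize `min (1 / β) y`. -/
lemma div_add_mul_min_le {A B β y : ℝ} (hA : 0 ≤ A) (hB : 0 ≤ B) (hβ : 0 < β) (hy : 0 < y) :
    A / min (1 / β) y + B * min (1 / β) y ≤ A * β + (A / y + B * y) := by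
  have h1 := mul_le_mul_of_nonneg_left (one_div_min_le (one_div_pos.2 hβ) hy) hA
  have h2 := mul_le_mul_of_nonneg_left (min_le_right (1 / β) y) hB
  rw [one_div_one_div, mul_add, mul_one_div, mul_one_div] at h1
  linarith

namespace IsStochasticAscent

variable {E : Type*} [NormedAddCommGroup E] [InnerProductSpace ℝ E]
    [CompleteSpace E] [MeasurableSpace E] {Ω : Type*} [MeasurableSpace Ω] {P : Measure Ω}
    {J : E → ℝ} {β C Δ : ℝ} {α : ℕ → ℝ} {θ₁ : E} {θ g : ℕ → Ω → E}

/-- For the degenerate case Δ = 0, where the constant stepsizes vanish and division by them fails: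
the iterates stay at `θ₁`, a maximizer. -/
lemma gradient_eq_zero {D : ℝ} (h : IsStochasticAscent P J β D α θ₁ θ g)
    (hΔ : (⨆ x, J x) - J θ₁ = 0) : ∇ J θ₁ = 0 := by
  have hmax : IsLocalMax J θ₁ := Filter.Eventually.of_forall fun x =>
    (le_ciSup h.bddAbove x).trans (sub_eq_zero.1 hΔ).le
  rw [gradient, hmax.fderiv_eq_zero, map_zero]

lemma iterate_eq {D : ℝ} (h : IsStochasticAscent P J β D α θ₁ θ g) {K : ℕ}
    (hα : ∀ k < K, α k = 0) {k : ℕ} (hk : k ≤ K) (ω : Ω) : θ k ω = θ₁ := by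
  induction k with
  | zero => exact h.zero ω
  | succ k ih => rw [h.succ, ih (Nat.le_of_succ_le hk), hα k hk, zero_smul, add_zero]

variable [BorelSpace E] [SecondCountableTopology E] [IsProbabilityMeasure P]

theorem average_integral_le (h : IsStochasticAscent P J β (C / 2) α θ₁ θ g) (hβ : 0 < β)
    (hC : 0 < C) (hΔ : Δ = (⨆ x, J x) - J θ₁) {K : ℕ} (hK : 1 ≤ K)
    (hα : ∀ k < K, α k = min (1 / β) (2 / C * √(2 * Δ / (β * K)))) :
    1 / (K : ℝ) * ∑ k ∈ Finset.range K, ∫ ω, ‖∇ J (θ k ω)‖ ^ 2 ∂P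
      ≤ 2 * β * Δ / K + C * √(β * Δ / (2 * K)) := by
  have hK0 : (0 : ℝ) < K := Nat.cast_pos.2 hK
  have hΔ0 : 0 ≤ Δ := hΔ ▸ sub_nonneg.2 (le_ciSup h.bddAbove θ₁)
  rcases hΔ0.eq_or_lt with h0 | hpos
  · have hα' : ∀ k < K, α k = 0 := fun k hk => by
      rw [hα k hk, ← h0]
      simp [hβ.le]
    have hz : ∑ k ∈ Finset.range K, ∫ ω, ‖∇ J (θ k ω)‖ ^ 2 ∂P = 0 :=
      Finset.sum_eq_zero fun k hk => by
        simp [h.iterate_eq hα' (Finset.mem_range.1 hk).le, h.gradient_eq_zero (hΔ ▸ h0.symm)]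
    rw [hz, mul_zero]
    positivity
  set s := √(2 * Δ / (β * K)) with hs
  have hs0 : 0 < s := Real.sqrt_pos.2 (by positivity)
  have hs2 : Δ / K = β * s ^ 2 / 2 := by
    rw [hs, Real.sq_sqrt (by positivity)]
    field_simp
  have hsq : √(β * Δ / (2 * K)) = β * s / 2 := by
    rw [Real.sqrt_eq_iff_eq_sq (by positivity) (by positivity),
      show β * Δ / (2 * K) = β / 2 * (Δ / K) by field_simp, hs2]
    ring
  have hy : 0 < 2 / C * s := by positivity
  set a := min (1 / β) (2 / C * s) with ha
  have ha0 : 0 < a := lt_min (by positivity) hy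
  have hsum : ∑ k ∈ Finset.range K, α k ^ 2 = K * a ^ 2 := by
    rw [Finset.sum_congr rfl fun k hk => by rw [hα k (Finset.mem_range.1 hk)], Finset.sum_const,
      Finset.card_range, nsmul_eq_mul]
  have h1 := h.sum_integral_le hβ.le K
  rw [Finset.sum_congr rfl fun k hk => by rw [hα k (Finset.mem_range.1 hk)],
    ← Finset.mul_sum, hsum, ← hΔ] at h1
  -- The second entry of the stepsize minimum is √(A/B), the minimizer of A/y + By, with minimum
  -- C√(βΔ/(2K)). The bias term comes out as βΔ/K, half of what is claimed.
  have h2 := div_add_mul_min_le (A := Δ / K) (B := β * C ^ 2 / 8) (by positivity) (by positivity)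
    hβ hy
  rw [← ha] at h2
  rw [mul_comm a, ← le_div_iff₀ ha0] at h1
  calc _ ≤ 1 / (K : ℝ) * ((Δ + β * (C / 2) ^ 2 / 2 * (K * a ^ 2)) / a) := by gcongr
    _ = Δ / K / a + β * C ^ 2 / 8 * a := by field_simp; ring
    _ ≤ _ := h2
    _ = β * Δ / K + C * (β * s / 2) := by
        rw [hs2, show β * Δ / K = β * (Δ / K) by ring, hs2]
        field_simp
        ring
    _ ≤ _ := by
        rw [hsq, mul_assoc 2 β, mul_div_assoc 2]
        have : 0 ≤ β * Δ / K := by positivity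
        linarith

theorem prob_average_le (h : IsStochasticAscent P J β (C / 2) α θ₁ θ g) (hβ : 0 < β)
    (hC : 0 < C) (hΔ : Δ = (⨆ x, J x) - J θ₁) {K : ℕ} (hK : 1 ≤ K) {δ : ℝ} (hδ₀ : 0 < δ)
    (hδ₁ : δ < 1) (hα : ∀ k < K, α k = min (1 / β) (1 / C * √(Δ / (β * K)))) :
    1 - δ ≤ P.real {ω | 1 / (K : ℝ) * ∑ k ∈ Finset.range K, ‖∇ J (θ k ω)‖ ^ 2
        ≤ 2 * β * Δ / K + 5 * C * √(β * Δ / K) + 12 * C ^ 2 * Real.log (1 / δ) / K} := by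
  have hK0 : (0 : ℝ) < K := Nat.cast_pos.2 hK
  have hlog : 0 ≤ Real.log (1 / δ) := Real.log_nonneg ((one_le_div hδ₀).2 hδ₁.le)
  have hΔ0 : 0 ≤ Δ := hΔ ▸ sub_nonneg.2 (le_ciSup h.bddAbove θ₁)
  rcases hΔ0.eq_or_lt with h0 | hpos
  · have hα' : ∀ k < K, α k = 0 := fun k hk => by
      rw [hα k hk, ← h0]
      simp [hβ.le]
    have hz : ∀ ω, ∑ k ∈ Finset.range K, ‖∇ J (θ k ω)‖ ^ 2 = 0 := fun ω =>
      Finset.sum_eq_zero fun k hk => by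
        simp [h.iterate_eq hα' (Finset.mem_range.1 hk).le, h.gradient_eq_zero (hΔ ▸ h0.symm)]
    have huniv : {ω | 1 / (K : ℝ) * ∑ k ∈ Finset.range K, ‖∇ J (θ k ω)‖ ^ 2
        ≤ 2 * β * Δ / K + 5 * C * √(β * Δ / K) + 12 * C ^ 2 * Real.log (1 / δ) / K} =
          Set.univ := Set.eq_univ_of_forall fun ω => by
      rw [Set.mem_ofPred_eq, hz, mul_zero]
      positivity
    rw [huniv, probReal_univ]
    linarith
  set s := √(Δ / (β * K)) with hs
  have hs0 : 0 < s := Real.sqrt_pos.2 (by positivity)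
  have hs2 : Δ / K = β * s ^ 2 := by
    rw [hs, Real.sq_sqrt (by positivity)]
    field_simp
  have hsq : √(β * Δ / K) = β * s := by
    rw [Real.sqrt_eq_iff_eq_sq (by positivity) (by positivity), mul_div_assoc, hs2]
    ring
  have hy : 0 < 1 / C * s := by positivity
  set a := min (1 / β) (1 / C * s) with ha
  have ha0 : 0 < a := lt_min (by positivity) hy
  have hsum : ∑ k ∈ Finset.range K, α k ^ 2 = K * a ^ 2 := by
    rw [Finset.sum_congr rfl fun k hk => by rw [hα k (Finset.mem_range.1 hk)], Finset.sum_const,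
      Finset.card_range, nsmul_eq_mul]
  -- This `l` makes the compensator exactly a/2, so half of each weight survives. The resulting
  -- constants 9/4 and 1/2 lie below the claimed 5 and 12.
  refine h.prob_sum_le hβ.le K (l := 4 / (C ^ 2 * a)) (by positivity) hδ₀ fun ω h1 => ?_
  rw [Finset.sum_congr (g := fun k => a / 2 * ‖∇ J (θ k ω)‖ ^ 2) rfl fun k hk => by
      rw [hα k (Finset.mem_range.1 hk)]; field_simp; ring,
    ← Finset.mul_sum, hsum, ← hΔ, mul_comm (a / 2),
    ← le_div_iff₀ (by positivity)] at h1
  have h2 := div_add_mul_min_le (A := 2 * (Δ / K)) (B := β * C ^ 2 / 4) (by positivity)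
    (by positivity) hβ hy
  rw [← ha] at h2
  rw [Set.mem_ofPred_eq]
  calc _ ≤ 1 / (K : ℝ) * ((Δ + β * (C / 2) ^ 2 / 2 * (K * a ^ 2) +
          Real.log (1 / δ) / (4 / (C ^ 2 * a))) / (a / 2)) := by gcongr
    _ = 2 * (Δ / K) / a + β * C ^ 2 / 4 * a + 1 / 2 * (C ^ 2 * Real.log (1 / δ) / K) := by
        field_simp; ring
    _ ≤ 2 * (Δ / K) * β + (2 * (Δ / K) / (1 / C * s) + β * C ^ 2 / 4 * (1 / C * s)) +
          1 / 2 * (C ^ 2 * Real.log (1 / δ) / K) := by gcongr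
    _ = 2 * β * Δ / K + 9 / 4 * (C * (β * s)) + 1 / 2 * (C ^ 2 * Real.log (1 / δ) / K) := by
        rw [show 2 * β * Δ / K = 2 * (Δ / K) * β by ring, hs2]
        field_simp
        ring
    _ ≤ _ := by
        rw [hsq, mul_assoc 12, mul_div_assoc 12]
        have h3 : 0 ≤ C ^ 2 * Real.log (1 / δ) / K := by positivity
        have h4 : 0 ≤ C * (β * s) := by positivity
        linarith

theorem prob_average_le_of_decreasing (h : IsStochasticAscent P J β (C / 2) α θ₁ θ g)
    (hβ : 0 < β) (hC : 0 < C) (hΔ : Δ = (⨆ x, J x) - J θ₁) {K : ℕ} (hK : 1 ≤ K) {δ : ℝ}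
    (hδ₀ : 0 < δ) (hδ₁ : δ < 1) (hα : ∀ k < K, α k = 1 / (β * √((k : ℝ) + 1))) :
    1 - δ ≤ P.real {ω | 1 / (K : ℝ) * ∑ k ∈ Finset.range K, ‖∇ J (θ k ω)‖ ^ 2
        ≤ (2 * β * Δ + 3 * C ^ 2 * (1 + Real.log K) + 12 * C ^ 2 * Real.log (1 / δ)) / √K} := by
  have hK0 : (0 : ℝ) < K := Nat.cast_pos.2 hK
  have hlog : 0 ≤ Real.log (1 / δ) := Real.log_nonneg ((one_le_div hδ₀).2 hδ₁.le)
  have hlogK : 0 ≤ Real.log K := Real.log_nonneg (Nat.one_le_cast.2 hK)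
  have hΔ0 : 0 ≤ Δ := hΔ ▸ sub_nonneg.2 (le_ciSup h.bddAbove θ₁)
  have hharm : ∑ k ∈ Finset.range K, α k ^ 2 ≤ (1 + Real.log K) / β ^ 2 := by
    have h1 := harmonic_le_one_add_log K
    rw [harmonic] at h1
    push_cast at h1
    refine le_trans (le_of_eq ?_) (div_le_div_of_nonneg_right h1 (sq_nonneg β))
    rw [Finset.sum_div]
    refine Finset.sum_congr rfl fun k hk => ?_
    rw [hα k (Finset.mem_range.1 hk), div_pow, mul_pow, Real.sq_sqrt (by positivity)]
    field_simp
  have hK1 : 0 < √(K : ℝ) := Real.sqrt_pos.2 hK0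
  -- Now the compensator is βα²/2, at most α/2 because βα ≤ 1. The remaining weight α/2 is at least
  -- 1/(2β√K), which is `hlow`.
  refine h.prob_sum_le hβ.le K (l := 4 * β / C ^ 2) (by positivity) hδ₀ fun ω h1 => ?_
  have hlow : 1 / (2 * β * √K) * ∑ k ∈ Finset.range K, ‖∇ J (θ k ω)‖ ^ 2 ≤
      ∑ k ∈ Finset.range K,
        (α k - 4 * β / C ^ 2 * (C / 2) ^ 2 / 2 * α k ^ 2) * ‖∇ J (θ k ω)‖ ^ 2 := by
    rw [Finset.mul_sum]
    refine Finset.sum_le_sum fun k hk => mul_le_mul_of_nonneg_right ?_ (sq_nonneg _)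
    have hkK := Finset.mem_range.1 hk
    have hr1 : 1 ≤ √((k : ℝ) + 1) := Real.one_le_sqrt.2 (by linarith [k.cast_nonneg (α := ℝ)])
    have hr2 : √((k : ℝ) + 1) ≤ √K := Real.sqrt_le_sqrt (by exact_mod_cast hkK)
    have hr0 : 0 < √((k : ℝ) + 1) := by linarith
    have hαβ : β * α k ≤ 1 := by
      rw [hα k hkK, show β * (1 / (β * √((k : ℝ) + 1))) = 1 / √((k : ℝ) + 1) by field_simp]
      exact (div_le_one hr0).2 hr1
    have hα0 : 0 < α k := by rw [hα k hkK]; positivity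
    calc 1 / (2 * β * √K) ≤ 1 / (2 * β * √((k : ℝ) + 1)) := by gcongr
      _ = α k / 2 := by rw [hα k hkK]; field_simp
      _ ≤ α k - β * α k * α k / 2 := by
          have := mul_le_mul_of_nonneg_right hαβ hα0.le
          linarith
      _ = _ := by field_simp; ring
  rw [← hΔ] at h1
  rw [Set.mem_ofPred_eq]
  have h2 : 1 / (2 * β * √K) * ∑ k ∈ Finset.range K, ‖∇ J (θ k ω)‖ ^ 2 ≤
      Δ + β * (C / 2) ^ 2 / 2 * ((1 + Real.log K) / β ^ 2) +
        Real.log (1 / δ) / (4 * β / C ^ 2) :=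
    hlow.trans (h1.trans (by gcongr))
  have hKK : (K : ℝ) = √K * √K := (Real.mul_self_sqrt hK0.le).symm
  calc 1 / (K : ℝ) * ∑ k ∈ Finset.range K, ‖∇ J (θ k ω)‖ ^ 2
      = 2 * β / √K * (1 / (2 * β * √K) * ∑ k ∈ Finset.range K, ‖∇ J (θ k ω)‖ ^ 2) := by
        rw [← mul_assoc]
        congr 1
        nth_rewrite 1 [hKK]
        field_simp
    _ ≤ 2 * β / √K * (Δ + β * (C / 2) ^ 2 / 2 * ((1 + Real.log K) / β ^ 2) +
          Real.log (1 / δ) / (4 * β / C ^ 2)) := by gcongr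
    _ = (2 * β * Δ + 1 / 4 * (C ^ 2 * (1 + Real.log K)) +
          1 / 2 * (C ^ 2 * Real.log (1 / δ))) / √K := by
        field_simp
        ring
    _ ≤ _ := by
        have h3 : 0 ≤ C ^ 2 * (1 + Real.log K) := by positivity
        have h4 : 0 ≤ C ^ 2 * Real.log (1 / δ) := by positivity
        gcongr ?_ / _
        linarith

end IsStochasticAscent

theorem mainTheorem4
    {O S A : Type*} [Finite O] [Finite S] [Finite A]
    [MeasurableSpace O] [MeasurableSpace S] [MeasurableSpace A]
    [MeasurableSingletonClass O] [MeasurableSingletonClass S] [MeasurableSingletonClass A]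
    (N : NMDP O A) (γ : ℝ) (hγ₀ : 0 < γ) (hγ₁ : γ < 1)
    (rmax : ℝ) (hrmax : 0 < rmax) (hr : ∀ t, 1 ≤ t → ∀ o a, |N.r t o a| ≤ rmax)
    (s₀ : S) (a₀ : A) {d : ℕ} (π : EuclideanSpace ℝ (Fin d) → ASMKernel O S A)
    (G M : ℝ) (hG : 0 < G) (hM : 0 < M) (hπ : IsRegularASM π G M)
    (θ₁ : EuclideanSpace ℝ (Fin d)) (α : ℕ → ℝ)
    {Ω : Type*} [MeasurableSpace Ω] (P : MeasureTheory.Measure Ω)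
    [MeasureTheory.IsProbabilityMeasure P] (τ : ℕ → Ω → Traj O S A)
    (hrun : N.IsASMPGRun γ s₀ a₀ π α θ₁ P τ)
    (J : EuclideanSpace ℝ (Fin d) → ℝ) (hJ : J = N.objective γ s₀ a₀ π)
    (θ : ℕ → Ω → EuclideanSpace ℝ (Fin d))
    (hθ : θ = fun k ω => N.iterate γ s₀ a₀ π α θ₁ (fun j => τ j ω) k)
    (Δ₁ C β : ℝ) (hΔ₁ : Δ₁ = (⨆ θ', J θ') - J θ₁) (hC : C = 2 * rmax * G / (1 - γ) ^ 2)
    (hβ : β = rmax / (1 - γ) ^ 2 * (M + G ^ 2 * (1 + γ) / (1 - γ))) :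
    -- the objective is differentiable and bounded above, so that its gradient and `Δ₁` make sense
    (Differentiable ℝ J ∧ BddAbove (Set.range J)) ∧
    -- (a) constant stepsize, in expectation
    (∀ K : ℕ, 1 ≤ K →
      (∀ k < K, α k = min (1 / β) (2 / C * √(2 * Δ₁ / (β * K)))) →
      (∀ k < K, MeasureTheory.Integrable (fun ω => ‖∇ J (θ k ω)‖ ^ 2) P) ∧
      1 / (K : ℝ) * ∑ k ∈ Finset.range K, ∫ ω, ‖∇ J (θ k ω)‖ ^ 2 ∂P
        ≤ 2 * β * Δ₁ / K + C * √(β * Δ₁ / (2 * K))) ∧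
    -- (b)(i) constant stepsize, with high probability
    (∀ K : ℕ, 1 ≤ K → ∀ δ : ℝ, 0 < δ → δ < 1 →
      (∀ k < K, α k = min (1 / β) (1 / C * √(Δ₁ / (β * K)))) →
      1 - δ ≤ P.real {ω | 1 / (K : ℝ) * ∑ k ∈ Finset.range K, ‖∇ J (θ k ω)‖ ^ 2
        ≤ 2 * β * Δ₁ / K + 5 * C * √(β * Δ₁ / K) + 12 * C ^ 2 * Real.log (1 / δ) / K}) ∧
    -- (b)(ii) decreasing stepsizes, with high probability
    (∀ K : ℕ, 1 ≤ K → ∀ δ : ℝ, 0 < δ → δ < 1 →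
      (∀ k < K, α k = 1 / (β * √((k : ℝ) + 1))) →
      1 - δ ≤ P.real {ω | 1 / (K : ℝ) * ∑ k ∈ Finset.range K, ‖∇ J (θ k ω)‖ ^ 2
        ≤ (2 * β * Δ₁ + 3 * C ^ 2 * (1 + Real.log K) + 12 * C ^ 2 * Real.log (1 / δ)) / √K}) ∧
    -- (c) Robbins–Monro stepsizes, almost surely
    ((∀ k, 0 < α k) →
      Filter.Tendsto (fun n => ∑ k ∈ Finset.range n, α k) Filter.atTop Filter.atTop →
      Summable (fun k => α k ^ 2) →
      ∀ᵐ ω ∂P, Filter.Tendsto (fun k => ‖∇ J (θ k ω)‖) Filter.atTop (nhds 0)) := by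

  have := Fintype.ofFinite O
  have := Fintype.ofFinite S
  have := Fintype.ofFinite A
  have h1γ : 0 < 1 - γ := sub_pos.2 hγ₁
  have hC0 : 0 < C := by rw [hC]; positivity
  have hβ0 : 0 < β := by rw [hβ]; positivity
  have h : IsStochasticAscent P J β (C / 2) α θ₁ θ
      (fun k ω => N.gradEst γ s₀ a₀ π (θ k ω) (τ k ω)) := by
    subst hJ hθ hβ
    have hC2 : C / 2 = rmax * G / (1 - γ) ^ 2 := by rw [hC]; ring
    rw [hC2]
    exact hrun.isStochasticAscent hγ₀.le hγ₁ hr hrmax.le hπ hG.le hM.le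
  exact ⟨⟨h.differentiable, h.bddAbove⟩,
    fun K hK hα => ⟨fun k _ => h.integrable_sq k, h.average_integral_le hβ0 hC0 hΔ₁ hK hα⟩,
    fun K hK δ hδ₀ hδ₁ hα => h.prob_average_le hβ0 hC0 hΔ₁ hK hδ₀ hδ₁ hα,
    fun K hK δ hδ₀ hδ₁ hα => h.prob_average_le_of_decreasing hβ0 hC0 hΔ₁ hK hδ₀ hδ₁ hα,
    fun hα hsum hsq => h.ae_tendsto_norm_gradient hβ0.le hα hsum hsq⟩
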